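/- Let $S^1=\mathbb R/2\pi\mathbb Z$ with parameter $s$ and $D_s=\partial/\partial s$; all maps are smooth. Let $$\mathcal M=\{\gamma:S^1\to\mathbb R^2\setminus\{0\}\mid \det(\gamma,\gamma_s)=1\},$$ and let $\kappa:S^1\to\mathbb R$ be the equicentroaffine curvature of $\gamma\in\mathcal M$, defined by $\gamma_{ss}=-\kappa\gamma$. The tangent space is $T_\gamma\mathcal M=\{-\tfrac12\alpha_s\gamma+\alpha\gamma_s\mid\alpha:S^1\to\mathbb R\}$. Let $\Omega=\tfrac12D_s^2+2\kappa+\kappa_sD_s^{-1}$ be the KdV recursion operator. For $n\ge1$ let $H_n(\gamma)=\int_{S^1}h_n(\kappa,\kappa_s,\kappa_{ss},\dots)\,ds$ be the $n$-th KdV Hamiltonian. Here $h_1=\kappa$, and for $n\ge2$, $h_n$ is a polynomial without constant term in $\kappa$ and its derivatives whose variational derivative $\delta H_n/\delta\kappa$ has no constant term and satisfies $D_s\,\delta H_n/\delta\kappa=\Omega^{n-2}\kappa_s$ (in $\Omega^{n-2}\kappa_s$, $D_s^{-1}$ is the inverse of $D_s$ on differential polynomials, with values without constant term). Such $h_n$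 exist for all $n\geq 1$. Let $C=(c_k)_{k\ge1}$ be a sequence of real numbers and $m\ge1$. Put $$\mathcal M(C_m)=\{\gamma\in\mathcal M\mid H_k(\gamma)=c_k,\ 1\le k\le m\},\qquad T_\gamma\mathcal M(C_m)=T_\gamma\mathcal M\cap\bigcap_{k=1}^m\ker (dH_k)_\gamma .$$ For $X=-\tfrac12\alpha_s\gamma+\alpha\gamma_s$ and $Y=-\tfrac12\beta_s\gamma+\beta\gamma_s$ in $T_\gamma\mathcal M(C_m)$ put $$\omega_{m+1}(X,Y)=\int_{S^1}\alpha\,\Omega^{m+1}\beta_s\,ds,$$ where $D_s^{-1}\beta_s=\beta$ and $D_s^{-1}\Omega^k\beta_s$ is a primitive of $\Omega^k\beta_s$ on $S^1$ for $1\le k\le m$; such primitives exist, and the value does not depend on the constants of integration. **Theorem.** The $S^1$-action $\gamma\mapsto\gamma(\cdot+\sigma)$ on $\mathcal M(C_m)$ is Hamiltonian with respect to $\omega_{m+1}$, with moment map $\mu_{m+1}:\mathcal M(C_m)\to\mathrm{Lie}(S^1)^*$ given by $$\mu_{m+1}(\gamma)\Big(\frac{\partial}{\partial\sigma}\Big)=H_{m+1}(\gamma),\qquad\gamma\in\mathcal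 M(C_m).$$ That is: the action preserves $\mathcal M(C_m)$, its tangent spaces and $\omega_{m+1}$; $\mu_{m+1}$ is invariant under the action; and for all $\xi\in\mathrm{Lie}(S^1)$ and $\gamma\in\mathcal M(C_m)$ the fundamental vector $\underline{\xi}_\gamma$ (which is $\gamma_s$ for $\xi=\partial/\partial\sigma$) lies in $T_\gamma\mathcal M(C_m)$, and $$d\langle\mu_{m+1},\xi\rangle_\gamma(Y)=\omega_{m+1}(\underline{\xi}_\gamma,Y)\qquad\text{for all }Y\in T_\gamma\mathcal M(C_m).$$ -/

import Mathlib

open scoped ContDiff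

namespace KdVCurve

noncomputable section

/-! ### Differential polynomials in one function `κ` and the KdV densities -/

/-- Polynomials in `κ, κ_s, κ_ss, …`; the variable `X i` stands for the `i`-th derivative of `κ`. -/
abbrev DiffPoly : Type := MvPolynomial ℕ ℝ

/-- The total derivative `D_s`: the derivation with `X i ↦ X (i + 1)`. -/
def totalD : Derivation ℝ DiffPoly DiffPoly :=
  MvPolynomial.mkDerivation ℝ (fun i => MvPolynomial.X (i + 1))

/-- The variational derivative `∑ i, (-1) ^ i D_s ^ i (∂p / ∂κ_i)`. -/
def varDeriv (p : DiffPoly) : DiffPoly :=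
  ∑ i ∈ p.vars, (-1 : ℝ) ^ i • (⇑totalD)^[i] (MvPolynomial.pderiv i p)

open Classical in
/-- `D_s⁻¹ p` for a differential polynomial `p`: the (unique) differential polynomial without
constant term whose total derivative is `p`; the value is `0` if there is none. -/
def formalDInv (p : DiffPoly) : DiffPoly :=
  if h : ∃ q : DiffPoly, MvPolynomial.constantCoeff q = 0 ∧ totalD q = p then h.choose else 0

/-- The recursion operator `Ω = (1/2) D_s² + 2 κ + κ_s D_s⁻¹` on differential polynomials. -/
def formalOmega (p : DiffPoly) : DiffPoly :=
  (1 / 2 : ℝ) • totalD (totalD p) + 2 * MvPolynomial.X 0 * p + MvPolynomial.X 1 * formalDInv p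

/-- `p` is an `n`-th KdV density: `h₁ = κ`, and for `n ≥ 2` the variational
derivative `δH_n/δκ` is the primitive without constant term of the right-hand side `Ω^(n-2) κ_s`
of the KdV hierarchy. Constants are not allowed in `h_n`. This fixes `h_n` up to a total
derivative, that is, it fixes the functional `H_n`. (There is no density with index `0`.) -/
def IsKdVDensity : ℕ → DiffPoly → Prop
  | 0, p => p = 0
  | 1, p => p = MvPolynomial.X 0
  | n + 2, p => MvPolynomial.constantCoeff p = 0 ∧
      MvPolynomial.constantCoeff (varDeriv p) = 0 ∧
      totalD (varDeriv p) = formalOmega^[n] (MvPolynomial.X 1)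

open Classical in
/-- The `n`-th KdV density `h_n` (one of them, all having the same functional `H_n`). -/
def kdvDensity (n : ℕ) : DiffPoly :=
  if h : ∃ p : DiffPoly, IsKdVDensity n p then h.choose else 0

/-! ### Calculus on the circle -/

/-- The circle `ℝ / 2πℤ`. -/
abbrev S1 : Type := AddCircle (2 * Real.pi)

/-- The plane; only its linear and smooth structures are used. -/
abbrev Plane : Type := Fin 2 → ℝ

/-- Smoothness of a map on the circle. -/
def IsSmooth {E : Type*} [NormedAddCommGroup E] [NormedSpace ℝ E] (f : S1 → E) : Prop :=
  ContDiff ℝ ∞ (fun s : ℝ => f (s : S1))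

/-- The derivative `D_s f` on the circle. -/
def dS {E : Type*} [NormedAddCommGroup E] [NormedSpace ℝ E] (f : S1 → E) : S1 → E :=
  fun x => deriv (fun t : ℝ => f (x + (t : S1))) 0

/-- The integral `∫_{S¹} f ds`. -/
def integralS1 (f : S1 → ℝ) : ℝ := ∫ s in (0 : ℝ)..(2 * Real.pi), f (s : S1)

/-- The determinant of the `2 × 2` matrix with rows `u`, `v`. -/
def det2 (u v : Plane) : ℝ := Matrix.det (Matrix.of ![u, v])

/-! ### Closed equicentroaffine curves -/

/-- The space `𝓜` of closed equicentroaffine plane curves. -/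
def curveSpace : Set (S1 → Plane) :=
  {γ | IsSmooth γ ∧ (∀ s, γ s ≠ 0) ∧ ∀ s, det2 (γ s) (dS γ s) = 1}

/-- The equicentroaffine curvature `κ`. On `curveSpace` it is the function with `γ_ss = -κ γ`
(see `dS_dS_eq`); the formula makes sense for every closed curve in the plane. -/
def curvature (γ : S1 → Plane) : S1 → ℝ := fun s => det2 (dS γ s) (dS (dS γ) s)

/-- The functional `H_n(γ) = ∫ h_n(κ, κ_s, κ_ss, …) ds`. -/
def hamiltonian (n : ℕ) (γ : S1 → Plane) : ℝ :=
  integralS1 (fun s => MvPolynomial.eval (fun i => dS^[i] (curvature γ) s) (kdvDensity n))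

/-- The level set `𝓜(C_m) = H₁⁻¹(c₁) ∩ … ∩ H_m⁻¹(c_m)`. -/
def levelSet (C : ℕ → ℝ) (m : ℕ) : Set (S1 → Plane) :=
  {γ | γ ∈ curveSpace ∧ ∀ k, 1 ≤ k → k ≤ m → hamiltonian k γ = C k}

/-- A smooth one-parameter family `Γ t` of closed plane curves with `Γ 0 = γ` and initial
velocity `Y`. -/
def IsVariation (γ Y : S1 → Plane) (Γ : ℝ → S1 → Plane) : Prop :=
  ContDiff ℝ ∞ (fun p : ℝ × ℝ => Γ p.1 (p.2 : S1)) ∧ Γ 0 = γ ∧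
    ∀ s, deriv (fun t => Γ t s) 0 = Y s

/-- `dF_γ(Y) = v`: the derivative of `F` along every smooth family of closed curves that starts
at `γ` with velocity `Y` is `v`. All families of closed plane curves are allowed, among them those
inside `curveSpace` and, for smooth `γ` and `Y`, the family `γ + t Y`. -/
def HasDifferential (F : (S1 → Plane) → ℝ) (γ Y : S1 → Plane) (v : ℝ) : Prop :=
  ∀ Γ : ℝ → S1 → Plane, IsVariation γ Y Γ → HasDerivAt (fun t => F (Γ t)) v 0

/-- The vector field `-(1/2) α_s γ + α γ_s` along `γ`. -/
def motionField (γ : S1 → Plane) (α : S1 → ℝ) : S1 → Plane :=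
  fun s => (-(1 / 2 : ℝ) * dS α s) • γ s + α s • dS γ s

/-- The tangent space `T_γ 𝓜 = {-(1/2) α_s γ + α γ_s | α : S¹ → ℝ}`. -/
def tangentCurveSpace (γ : S1 → Plane) : Set (S1 → Plane) :=
  {X | ∃ α : S1 → ℝ, IsSmooth α ∧ X = motionField γ α}

/-- The tangent space `T_γ 𝓜(C_m) = T_γ 𝓜 ∩ Ker (dH₁)_γ ∩ … ∩ Ker (dH_m)_γ`. -/
def tangentLevelSet (m : ℕ) (γ : S1 → Plane) : Set (S1 → Plane) :=
  {X | X ∈ tangentCurveSpace γ ∧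
    ∀ k, 1 ≤ k → k ≤ m → HasDifferential (hamiltonian k) γ X 0}

/-! ### The recursion operator and the forms `ω_{m+1}` -/

/-- `Ω D_s b = (1/2) b_sss + 2 κ b_s + κ_s b`, where `D_s⁻¹ D_s b` is `b`. -/
def omegaD (κ b : S1 → ℝ) : S1 → ℝ :=
  fun s => (1 / 2 : ℝ) * dS (dS (dS b)) s + 2 * κ s * dS b s + dS κ s * b s

/-- `b k` is a primitive `D_s⁻¹ Ω^k β_s` on the circle for `k = 0, …, m`, with `b 0 = β`. The
constants of integration are arbitrary for `1 ≤ k ≤ m`. -/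
def IsRecursionChain (κ : S1 → ℝ) (m : ℕ) (β : S1 → ℝ) (b : ℕ → S1 → ℝ) : Prop :=
  b 0 = β ∧ (∀ k ≤ m, IsSmooth (b k)) ∧ ∀ k < m, dS (b (k + 1)) = omegaD κ (b k)

/-- `∫ α Ω^(m+1) β_s ds`, computed with the primitives `b`, so that
`Ω^(m+1) β_s = Ω D_s (b m)`. -/
def chainPairing (κ : S1 → ℝ) (m : ℕ) (α : S1 → ℝ) (b : ℕ → S1 → ℝ) : ℝ :=
  integralS1 (fun s => α s * omegaD κ (b m) s)

/-- The function `α` of `X = -(1/2) α_s γ + α γ_s`, recovered as `det (γ, X)`. -/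
def coord (γ X : S1 → Plane) : S1 → ℝ := fun s => det2 (γ s) (X s)

open Classical in
/-- `ω_{m+1}(X, Y) = ∫ α Ω^(m+1) β_s ds` for `X = -(1/2) α_s γ + α γ_s` and
`Y = -(1/2) β_s γ + β γ_s`, computed with some choice of the primitives `D_s⁻¹ Ω^k β_s`
(and `0` if they do not exist). -/
def omegaForm (m : ℕ) (γ X Y : S1 → Plane) : ℝ :=
  if h : ∃ b, IsRecursionChain (curvature γ) m (coord γ Y) b then
    chainPairing (curvature γ) m (coord γ X) h.choose
  else 0

/-! ### The circle action and its moment map -/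

/-- The `S¹`-action `γ ↦ γ(· + σ)`. The same formula gives its differential on vector fields
along curves. -/
def shift (σ : S1) (γ : S1 → Plane) : S1 → Plane := fun s => γ (s + σ)

/-- The fundamental vector field of `ξ ∂/∂σ ∈ Lie(S¹) = ℝ ∂/∂σ` at `γ`. -/
def fundamentalField (ξ : ℝ) (γ : S1 → Plane) : S1 → Plane :=
  fun s => deriv (fun t : ℝ => shift ((t * ξ : ℝ) : S1) γ s) 0

/-- The `S¹`-action on `𝓜(C_m)` is Hamiltonian with respect to `ω_{m+1}`, with moment map `μ`.
Here `Lie(S¹)` is identified with `ℝ`, the vector `∂/∂σ` corresponding to `1`. -/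
structure IsHamiltonianWithMomentMap (C : ℕ → ℝ) (m : ℕ)
    (μ : (S1 → Plane) → Module.Dual ℝ ℝ) : Prop where
  /-- The circle acts on `𝓜(C_m)`. -/
  shift_mem : ∀ σ, ∀ γ ∈ levelSet C m, shift σ γ ∈ levelSet C m
  /-- The action maps tangent vectors to tangent vectors. -/
  shift_tangent : ∀ σ, ∀ γ ∈ levelSet C m, ∀ X ∈ tangentLevelSet m γ,
    shift σ X ∈ tangentLevelSet m (shift σ γ)
  /-- The action leaves `ω_{m+1}` invariant. -/
  form_invariant : ∀ σ, ∀ γ ∈ levelSet C m, ∀ X ∈ tangentLevelSet m γ,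
    ∀ Y ∈ tangentLevelSet m γ,
      omegaForm m (shift σ γ) (shift σ X) (shift σ Y) = omegaForm m γ X Y
  /-- The fundamental vector fields are tangent to `𝓜(C_m)`. -/
  fundamental_tangent : ∀ ξ, ∀ γ ∈ levelSet C m,
    fundamentalField ξ γ ∈ tangentLevelSet m γ
  /-- `μ` is equivariant (the coadjoint action of the circle is trivial). -/
  equivariant : ∀ σ, ∀ γ ∈ levelSet C m, μ (shift σ γ) = μ γ
  /-- `d⟨μ, ξ⟩ = ω_{m+1}(ξ_𝓜, ·)` on `T 𝓜(C_m)`. -/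
  differential : ∀ ξ, ∀ γ ∈ levelSet C m, ∀ Y ∈ tangentLevelSet m γ,
    HasDifferential (fun γ' => μ γ' ξ) γ Y (omegaForm m γ (fundamentalField ξ γ) Y)

/-! ### The curvature formula -/

theorem dS_coe {E : Type*} [NormedAddCommGroup E] [NormedSpace ℝ E] (f : S1 → E) (s : ℝ) :
    dS f (s : S1) = deriv (fun t : ℝ => f (t : S1)) s := by
  have h := deriv_comp_const_add (f := fun t : ℝ => f (t : S1)) s 0
  simp only [add_zero] at h
  rw [← h]
  simp [dS]

theorem IsSmooth.dS {E : Type*} [NormedAddCommGroup E] [NormedSpace ℝ E] {f : S1 → E}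
    (hf : IsSmooth f) : IsSmooth (dS f) := by
  have h : (fun s : ℝ => KdVCurve.dS f (s : S1)) = deriv (fun t : ℝ => f (t : S1)) := by
    funext s; exact dS_coe f s
  unfold IsSmooth
  rw [h]
  exact ((contDiff_infty_iff_deriv (𝕜 := ℝ)).1 hf).2

/-- On `𝓜` the function `curvature γ` is the equicentroaffine curvature: `γ_ss = -κ γ`. -/
theorem dS_dS_eq {γ : S1 → Plane} (hγ : γ ∈ curveSpace) (x : S1) :
    dS (dS γ) x = -(curvature γ x) • γ x := by
  obtain ⟨hs, -, hdet⟩ := hγ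
  induction x using QuotientAddGroup.induction_on with
  | H s =>
    have h1 : HasDerivAt (fun t : ℝ => γ (t : S1)) (dS γ (s : S1)) s := by
      rw [dS_coe]
      exact (hs.differentiable (by simp) s).hasDerivAt
    have h2 : HasDerivAt (fun t : ℝ => dS γ (t : S1)) (dS (dS γ) (s : S1)) s := by
      rw [dS_coe]
      exact (hs.dS.differentiable (by simp) s).hasDerivAt
    rw [hasDerivAt_pi] at h1 h2
    have h3 := ((h1 0).mul (h2 1)).sub ((h1 1).mul (h2 0))
    have h4 : HasDerivAt (fun t : ℝ => det2 (γ (t : S1)) (dS γ (t : S1))) 0 s := by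
      simp only [hdet]
      exact hasDerivAt_const _ _
    have h5 := h4.unique (h3.congr_of_eventuallyEq (Filter.Eventually.of_forall fun t => by
      simp [det2, Matrix.det_fin_two]))
    have h6 := hdet (s : S1)
    change dS (dS γ) (s : S1) = -(curvature γ (s : S1)) • γ (s : S1)
    simp only [det2, Matrix.det_fin_two] at h6
    simp at h6
    funext i
    simp only [curvature, det2, Matrix.det_fin_two]
    fin_cases i
    · simp
      linear_combination (-(dS (dS γ) (s : S1) 0)) * h6 - dS γ (s : S1) 0 * h5
    · simp
      linear_combination (-(dS (dS γ) (s : S1) 1)) * h6 - dS γ (s : S1) 1 * h5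

end

end KdVCurve

open KdVCurve

/-! The operator `Ω D_s = (1/2) D_s³ + 2 κ D_s + κ_s` is skew-adjoint, and everything rests on
sequences `b` with `D_s b_{k+1} = Ω D_s b_k`.

On differential polynomials, start such a sequence at `b₀ = 1`. Skew-adjointness moves operators from
one factor to the other, so that `b₀ Ω D_s b_k ≡ b_k Ω D_s b₀ ≡ -b₀ Ω D_s b_k` modulo total
derivatives; hence `Ω D_s b_k` is exact and `b_{k+1}` exists. This is the Lenard sequence `lenard`,
and `Ω^n κ_s = D_s b_{n+1}` (`formalOmega_iterate`). Its generating series `B = ∑ b_k z^k` has the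
first integral `B² - z (B B'' - B'²/2 + 2 κ B²) = 1` (`lenardSeries_relation`). Linearizing this
relation in `κ`, and comparing with its `z`-derivative, yields `δB/δκ = z (2 z ∂_z + 1) B`, that is
`δb_{n+1}/δκ = (2n + 1) b_n` (`varDeriv_lenard_succ`). Consequently `b_n / (2n - 1)` is an `n`-th KdV
density, and every choice of the density has variational derivative `δH_{k+1}/δκ = b_k`, because a
differential polynomial is determined by its total derivative and its constant term.

On a curve, the motion with function `α` changes the curvature by `Ω D_s α` (`curvature_variation`),
so that `dH_{k+1}(X) = ∫ b_k Ω D_s α` (`hasDifferential_hamiltonian`). For two recursion chains `a`,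
`b` on the circle, skew-adjointness gives `∫ a₀ Ω D_s b_j = ∫ a_j Ω D_s b₀` (`integralS1_chain`).
Three instances prove the theorem. With `a` the Lenard sequence evaluated at `κ`, the mean of
`Ω D_s β_j` is `dH_{j+1}(Y)`; it vanishes for `j < m` when `Y` is tangent to the level set, so the
primitives in `ω_{m+1}` exist. With `a` a chain of the other tangent vector,
`ω_{m+1}(X, Y) = ∫ a_m Ω D_s β` does not see the constants of integration of the chain of `Y`.
Finally `∂/∂σ` acts by the constant function `α = 1 = b₀`, so that
`ω_{m+1}(γ_s, Y) = ∫ b_m Ω D_s β = dH_{m+1}(Y)`. -/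

namespace KdVCurve

noncomputable section

/-! ### Differential polynomials -/

@[simp] theorem totalD_X (i : ℕ) : totalD (MvPolynomial.X i) = MvPolynomial.X (i + 1) :=
  MvPolynomial.mkDerivation_X ℝ _ i

theorem pderiv_zero_totalD (p : DiffPoly) :
    MvPolynomial.pderiv 0 (totalD p) = totalD (MvPolynomial.pderiv 0 p) := by
  have h : ⁅(MvPolynomial.pderiv 0 : Derivation ℝ DiffPoly DiffPoly), totalD⁆ = 0 :=
    MvPolynomial.derivation_ext fun j => by
      rw [Derivation.commutator_apply]
      by_cases hj : j = 0
      · subst hj; simp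
      · simp [MvPolynomial.pderiv_X, hj]
  have := congrArg (fun d => d p) h
  rwa [Derivation.commutator_apply, Derivation.zero_apply, sub_eq_zero] at this

theorem pderiv_succ_totalD (i : ℕ) (p : DiffPoly) :
    MvPolynomial.pderiv (i + 1) (totalD p) =
      totalD (MvPolynomial.pderiv (i + 1) p) + MvPolynomial.pderiv i p := by
  have h : ⁅(MvPolynomial.pderiv (i + 1) : Derivation ℝ DiffPoly DiffPoly), totalD⁆ =
      MvPolynomial.pderiv i :=
    MvPolynomial.derivation_ext fun j => by
      rw [Derivation.commutator_apply]
      by_cases hj : j = i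
      · subst hj; simp [MvPolynomial.pderiv_X]
      · by_cases hj' : j = i + 1
        · subst hj'; simp [MvPolynomial.pderiv_X]
        · simp [MvPolynomial.pderiv_X, hj, hj']
  have := congrArg (fun d => d p) h
  simp only [Derivation.commutator_apply] at this
  rw [← this]; ring

theorem pderiv_eq_zero_of_vars_subset {p : DiffPoly} {N : ℕ} (h : p.vars ⊆ Finset.range N)
    {i : ℕ} (hi : N ≤ i) : MvPolynomial.pderiv i p = 0 :=
  MvPolynomial.pderiv_eq_zero_of_notMem_vars fun hmem => by
    have := Finset.mem_range.1 (h hmem); omega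

theorem exists_vars_subset_range (p : DiffPoly) : ∃ N, p.vars ⊆ Finset.range N :=
  Finset.exists_nat_subset_range _

theorem eq_C_of_forall_pderiv_eq_zero {p : DiffPoly}
    (h : ∀ i, MvPolynomial.pderiv i p = 0) : p = MvPolynomial.C (MvPolynomial.constantCoeff p) := by
  ext m
  rw [MvPolynomial.coeff_C]
  split_ifs with hm
  · rw [← hm]; rfl
  · obtain ⟨i, hi⟩ : ∃ i, m i ≠ 0 := by
      by_contra hcon
      push Not at hcon
      exact hm (Finsupp.ext fun i => (hcon i).symm)
    have h1 := congrArg (MvPolynomial.coeff (m - Finsupp.single i 1)) (h i)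
    have h2 : m - Finsupp.single i 1 + Finsupp.single i 1 = m := by
      ext j
      by_cases hj : j = i
      · subst hj; simp; omega
      · simp [Ne.symm hj]
    rw [MvPolynomial.coeff_pderiv, h2, MvPolynomial.coeff_zero] at h1
    rcases mul_eq_zero.1 h1 with h1 | h1
    · exact h1
    · exfalso
      have : (0 : ℝ) ≤ ((m - Finsupp.single i 1 : ℕ →₀ ℕ) i : ℝ) := Nat.cast_nonneg _
      linarith

/-- The constants are the only differential polynomials with vanishing total derivative: if all
variables of `p` have index at most `N`, then `∂p/∂κ_N` is the coefficient of `κ_{N+1}` in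
`D_s p`. -/
theorem eq_C_of_totalD_eq_zero {p : DiffPoly} (h : totalD p = 0) :
    p = MvPolynomial.C (MvPolynomial.constantCoeff p) := by
  refine eq_C_of_forall_pderiv_eq_zero ?_
  obtain ⟨N, hN⟩ := exists_vars_subset_range p
  -- descending induction on the index `i`, starting above all variables of `p`
  suffices H : ∀ k i, N ≤ i + k → MvPolynomial.pderiv i p = 0 from fun i => H N i (by omega)
  intro k
  induction k with
  | zero => exact fun i hi => pderiv_eq_zero_of_vars_subset hN hi
  | succ k ih =>
    intro i hi
    have h1 := pderiv_succ_totalD i p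
    rw [h, ih (i + 1) (by omega)] at h1
    simpa using h1.symm

theorem eq_of_totalD_eq {p q : DiffPoly} (h : totalD p = totalD q)
    (hc : MvPolynomial.constantCoeff p = MvPolynomial.constantCoeff q) : p = q := by
  have h1 := eq_C_of_totalD_eq_zero (p := p - q) (by rw [map_sub, h, sub_self])
  rw [map_sub, hc, sub_self, map_zero] at h1
  exact sub_eq_zero.1 h1

theorem constantCoeff_totalD (p : DiffPoly) : MvPolynomial.constantCoeff (totalD p) = 0 := by
  induction p using MvPolynomial.induction_on with
  | C a => simp [totalD]
  | add p q hp hq => simp [hp, hq]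
  | mul_X p i hp => simp [Derivation.leibniz, hp]

theorem formalDInv_spec {p : DiffPoly} (h : ∃ q, totalD q = p) :
    MvPolynomial.constantCoeff (formalDInv p) = 0 ∧ totalD (formalDInv p) = p := by
  have h' : ∃ q : DiffPoly, MvPolynomial.constantCoeff q = 0 ∧ totalD q = p := by
    obtain ⟨q, hq⟩ := h
    refine ⟨q - MvPolynomial.C (MvPolynomial.constantCoeff q), by simp, ?_⟩
    rw [map_sub, hq]
    simp [totalD]
  rw [formalDInv, dif_pos h']
  exact h'.choose_spec

theorem formalDInv_totalD {p : DiffPoly} (h : MvPolynomial.constantCoeff p = 0) :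
    formalDInv (totalD p) = p :=
  have hs := formalDInv_spec ⟨p, rfl⟩
  eq_of_totalD_eq hs.2 (hs.1.trans h.symm)

/-! ### The Lenard recursion -/

/-- The operator `Ω D_s = (1/2) D_s³ + 2 κ D_s + κ_s` on differential polynomials. -/
def formalOmegaD (p : DiffPoly) : DiffPoly :=
  (1 / 2 : ℝ) • totalD (totalD (totalD p)) + 2 * MvPolynomial.X 0 * totalD p +
    MvPolynomial.X 1 * p

/-- The operator `Ω D_s` is skew-adjoint modulo total derivatives. -/
theorem exists_totalD_eq_skew (p q : DiffPoly) :
    ∃ r, totalD r = p * formalOmegaD q + formalOmegaD p * q := by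
  refine ⟨(1 / 2 : ℝ) • (p * totalD (totalD q) + q * totalD (totalD p) - totalD p * totalD q) +
    (2 : ℝ) • (MvPolynomial.X 0 * (p * q)), ?_⟩
  rw [map_add, Derivation.map_smul, Derivation.map_smul]
  simp only [formalOmegaD, map_add, map_sub, Derivation.leibniz, smul_eq_mul,
    totalD_X, MvPolynomial.smul_eq_C_mul]
  have h2 : (MvPolynomial.C (2 : ℝ) : DiffPoly) = 2 := map_ofNat _ 2
  rw [h2]
  ring

/-- The Lenard sequence: `b 0 = 1` and `D_s (b (k + 1)) = Ω D_s (b k)`, where `b (k + 1)` has no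
constant term. -/
def lenard : ℕ → DiffPoly
  | 0 => 1
  | k + 1 => formalDInv (formalOmegaD (lenard k))

/-- If the Lenard sequence is well defined up to index `k`, then `b 0 * Ω D_s (b k)` is congruent
to `b i * Ω D_s (b (k - i))` modulo total derivatives. -/
theorem exists_totalD_eq_lenard_sub {k : ℕ}
    (h : ∀ j < k, totalD (lenard (j + 1)) = formalOmegaD (lenard j)) (i j : ℕ) (hij : i + j = k) :
    ∃ r, totalD r = lenard 0 * formalOmegaD (lenard k) - lenard i * formalOmegaD (lenard j) := by
  induction i generalizing j with
  | zero => exact ⟨0, by rw [show j = k by omega]; simp⟩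
  | succ i ih =>
    obtain ⟨r, hr⟩ := ih (j + 1) (by omega)
    obtain ⟨t, ht⟩ := exists_totalD_eq_skew (lenard i) (lenard (j + 1))
    refine ⟨r + t - lenard (i + 1) * lenard (j + 1), ?_⟩
    rw [map_sub, map_add, hr, ht, Derivation.leibniz, h i (by omega), h j (by omega)]
    simp only [smul_eq_mul]
    ring

/-- `Ω D_s (b k)` is congruent to `b k * Ω D_s 1` by telescoping, and to its negative by
skew-adjointness, so it is a total derivative. -/
theorem exists_totalD_eq_formalOmegaD_lenard {k : ℕ}
    (h : ∀ j < k, totalD (lenard (j + 1)) = formalOmegaD (lenard j)) :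
    ∃ r, totalD r = formalOmegaD (lenard k) := by
  obtain ⟨r, hr⟩ := exists_totalD_eq_lenard_sub h k 0 (by omega)
  obtain ⟨t, ht⟩ := exists_totalD_eq_skew (lenard k) (lenard 0)
  refine ⟨(1 / 2 : ℝ) • (r + t), ?_⟩
  rw [Derivation.map_smul, map_add, hr, ht, lenard]
  simp only [MvPolynomial.smul_eq_C_mul]
  have h2 : (MvPolynomial.C (1 / 2 : ℝ) : DiffPoly) * 2 = 1 := by
    rw [← map_ofNat MvPolynomial.C 2, ← map_mul]; norm_num
  linear_combination formalOmegaD (lenard k) * h2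

theorem totalD_lenard_succ (k : ℕ) : totalD (lenard (k + 1)) = formalOmegaD (lenard k) := by
  induction k using Nat.strong_induction_on with
  | _ k ih => exact (formalDInv_spec (exists_totalD_eq_formalOmegaD_lenard ih)).2

theorem constantCoeff_lenard_succ (k : ℕ) : MvPolynomial.constantCoeff (lenard (k + 1)) = 0 :=
  (formalDInv_spec ⟨_, totalD_lenard_succ k⟩).1

theorem formalOmega_totalD_lenard_succ (k : ℕ) :
    formalOmega (totalD (lenard (k + 1))) = totalD (lenard (k + 2)) := by
  rw [totalD_lenard_succ (k + 1), formalOmega, formalDInv_totalD (constantCoeff_lenard_succ k),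
    formalOmegaD]

theorem lenard_one : lenard 1 = MvPolynomial.X 0 := by
  refine eq_of_totalD_eq ?_ (by rw [constantCoeff_lenard_succ, MvPolynomial.constantCoeff_X])
  rw [totalD_lenard_succ, formalOmegaD, lenard]
  simp

theorem formalOmega_iterate (n : ℕ) :
    formalOmega^[n] (MvPolynomial.X 1) = totalD (lenard (n + 1)) := by
  induction n with
  | zero => simp [lenard_one]
  | succ n ih => rw [Function.iterate_succ_apply', ih, formalOmega_totalD_lenard_succ]

/-! ### The adjoint of the linearization -/

/-- The formal adjoint `r ↦ ∑ i, (-D_s) ^ i (∂p/∂κ_i * r)` of the linearization of `p`. -/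
def adj (p r : DiffPoly) : DiffPoly :=
  ∑ i ∈ p.vars, (-1 : ℝ) ^ i • (⇑totalD)^[i] (MvPolynomial.pderiv i p * r)

theorem varDeriv_eq_adj_one (p : DiffPoly) : varDeriv p = adj p 1 := by
  simp [varDeriv, adj]

theorem iterate_totalD_zero (i : ℕ) : (⇑totalD)^[i] 0 = 0 :=
  Function.iterate_fixed (map_zero _) i

theorem iterate_totalD_add (i : ℕ) (p q : DiffPoly) :
    (⇑totalD)^[i] (p + q) = (⇑totalD)^[i] p + (⇑totalD)^[i] q :=
  iterate_map_add totalD i p q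

theorem iterate_totalD_smul (i : ℕ) (c : ℝ) (p : DiffPoly) :
    (⇑totalD)^[i] (c • p) = c • (⇑totalD)^[i] p := by
  induction i with
  | zero => rfl
  | succ i ih => rw [Function.iterate_succ_apply', ih, Derivation.map_smul,
      Function.iterate_succ_apply']

theorem adj_eq_sum_range {p : DiffPoly} {N : ℕ} (h : p.vars ⊆ Finset.range N) (r : DiffPoly) :
    adj p r =
      ∑ i ∈ Finset.range N, (-1 : ℝ) ^ i • (⇑totalD)^[i] (MvPolynomial.pderiv i p * r) :=
  Finset.sum_subset h fun i _ hi => by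
    rw [MvPolynomial.pderiv_eq_zero_of_notMem_vars hi, zero_mul, iterate_totalD_zero, smul_zero]

theorem adj_add_left (p q r : DiffPoly) : adj (p + q) r = adj p r + adj q r := by
  obtain ⟨N, hN⟩ := Finset.exists_nat_subset_range (p.vars ∪ q.vars)
  rw [adj_eq_sum_range ((MvPolynomial.vars_add_subset p q).trans hN),
    adj_eq_sum_range (Finset.subset_union_left.trans hN),
    adj_eq_sum_range (Finset.subset_union_right.trans hN), ← Finset.sum_add_distrib]
  simp only [map_add, add_mul, iterate_totalD_add, smul_add]

theorem adj_add_right (p q r : DiffPoly) : adj p (q + r) = adj p q + adj p r := by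
  simp only [adj, mul_add, iterate_totalD_add, smul_add, Finset.sum_add_distrib]

theorem adj_C (c : ℝ) (r : DiffPoly) : adj (MvPolynomial.C c) r = 0 := by
  simp [adj]

theorem adj_X_zero (r : DiffPoly) : adj (MvPolynomial.X 0) r = r := by
  simp [adj, MvPolynomial.vars_X]

theorem adj_mul (p q r : DiffPoly) : adj (p * q) r = adj p (q * r) + adj q (p * r) := by
  obtain ⟨N, hN⟩ := Finset.exists_nat_subset_range (p.vars ∪ q.vars)
  rw [adj_eq_sum_range ((MvPolynomial.vars_mul p q).trans hN),
    adj_eq_sum_range (Finset.subset_union_left.trans hN),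
    adj_eq_sum_range (Finset.subset_union_right.trans hN), ← Finset.sum_add_distrib]
  refine Finset.sum_congr rfl fun i _ => ?_
  rw [← smul_add, ← iterate_totalD_add, Derivation.leibniz]
  congr 2
  simp only [smul_eq_mul]
  ring

/-- Linearization commutes with `D_s`, and `-D_s` is the adjoint of `D_s`. -/
theorem adj_totalD (p r : DiffPoly) : adj (totalD p) r = -adj p (totalD r) := by
  obtain ⟨N, hN⟩ := Finset.exists_nat_subset_range (p.vars ∪ (totalD p).vars)
  have hp : p.vars ⊆ Finset.range N := Finset.subset_union_left.trans hN
  have hp' : p.vars ⊆ Finset.range (N + 1) :=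
    hp.trans (Finset.range_mono (Nat.le_succ N))
  have hD : (totalD p).vars ⊆ Finset.range (N + 1) :=
    (Finset.subset_union_right.trans hN).trans (Finset.range_mono (Nat.le_succ N))
  have hleib : ∀ i, totalD (MvPolynomial.pderiv i p) * r =
      totalD (MvPolynomial.pderiv i p * r) - MvPolynomial.pderiv i p * totalD r := by
    intro i
    rw [Derivation.leibniz]; simp only [smul_eq_mul]; ring
  have hit : ∀ i (u v : DiffPoly), (⇑totalD)^[i] (totalD u - v) =
      (⇑totalD)^[i + 1] u - (⇑totalD)^[i] v := by
    intro i u v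
    rw [Function.iterate_succ_apply]
    exact iterate_map_sub totalD i _ _
  set T : ℕ → DiffPoly := fun i =>
    (-1 : ℝ) ^ i • (⇑totalD)^[i + 1] (MvPolynomial.pderiv i p * r) with hT
  set S : ℕ → DiffPoly := fun i =>
    (-1 : ℝ) ^ i • (⇑totalD)^[i] (MvPolynomial.pderiv i p * totalD r) with hS
  have h0 : (-1 : ℝ) ^ 0 • (⇑totalD)^[0] (MvPolynomial.pderiv 0 (totalD p) * r) = T 0 - S 0 := by
    rw [pderiv_zero_totalD, hleib, hit, smul_sub]
  have h1 : ∀ i, (-1 : ℝ) ^ (i + 1) •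
      (⇑totalD)^[i + 1] (MvPolynomial.pderiv (i + 1) (totalD p) * r) =
        (T (i + 1) - T i) - S (i + 1) := by
    intro i
    rw [pderiv_succ_totalD, add_mul, iterate_totalD_add, hleib, hit]
    simp only [hT, hS]
    rw [smul_add, smul_sub, pow_succ (-1 : ℝ) i]
    simp only [mul_neg, mul_one, neg_smul]
    abel
  have hTN : T N = 0 := by
    simp only [hT]
    rw [pderiv_eq_zero_of_vars_subset hp le_rfl, zero_mul, iterate_totalD_zero, smul_zero]
  rw [adj_eq_sum_range hD, adj_eq_sum_range hp', Finset.sum_range_succ', h0,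
    Finset.sum_range_succ' (fun i => S i)]
  simp only [h1]
  rw [Finset.sum_sub_distrib, Finset.sum_range_sub, hTN]
  abel

section Series

/-! ### The generating series of the Lenard sequence -/

open PowerSeries in
/-- The total derivative, acting on the coefficients of a power series. -/
def seriesD : Derivation ℝ (PowerSeries DiffPoly) (PowerSeries DiffPoly) :=
  Derivation.mk'
    { toFun := fun f => PowerSeries.mk fun n => totalD (coeff n f)
      map_add' := fun f g => by ext1 n; simp
      map_smul' := fun c f => by
        ext1 n
        rw [coeff_mk]
        refine (totalD.map_smul c (coeff n f)).trans ?_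
        change _ = c • coeff n (PowerSeries.mk fun n => totalD (coeff n f))
        rw [coeff_mk] }
    fun f g => by
      ext1 n
      simp only [LinearMap.coe_mk, AddHom.coe_mk, coeff_mk, coeff_mul, map_sum, smul_eq_mul, map_add,
        Derivation.leibniz, Finset.sum_add_distrib]
      congr 1
      rw [← Finset.Nat.sum_antidiagonal_swap]
      rfl

open PowerSeries

theorem coeff_seriesD (n : ℕ) (f : PowerSeries DiffPoly) :
    coeff n (seriesD f) = totalD (coeff n f) := by
  simp [seriesD]

@[simp] theorem seriesD_X : seriesD (PowerSeries.X : PowerSeries DiffPoly) = 0 := by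
  ext1 n
  rw [coeff_seriesD, coeff_X]
  split_ifs <;> simp

@[simp] theorem seriesD_C (p : DiffPoly) : seriesD (C p) = C (totalD p) := by
  ext1 n
  rw [coeff_seriesD, coeff_C, coeff_C]
  split_ifs <;> simp

theorem derivative_seriesD (f : PowerSeries DiffPoly) :
    d⁄dX DiffPoly (seriesD f) = seriesD (d⁄dX DiffPoly f) := by
  ext1 n
  simp only [coeff_derivative, coeff_seriesD, Derivation.leibniz, smul_eq_mul]
  have : totalD ((n : DiffPoly) + 1) = 0 := by
    rw [map_add]; simp
  rw [this]; ring

/-- A power series with vanishing total derivative is determined by its constant terms. -/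
theorem eq_of_seriesD_eq {f g : PowerSeries DiffPoly} (h : seriesD f = seriesD g)
    (hc : PowerSeries.map MvPolynomial.constantCoeff f =
      PowerSeries.map MvPolynomial.constantCoeff g) : f = g := by
  ext1 n
  refine eq_of_totalD_eq ?_ ?_
  · rw [← coeff_seriesD, h, coeff_seriesD]
  · simpa using congrArg (coeff n) hc

theorem map_constantCoeff_seriesD (f : PowerSeries DiffPoly) :
    PowerSeries.map MvPolynomial.constantCoeff (seriesD f) = 0 := by
  ext1 n
  rw [coeff_map, coeff_seriesD, constantCoeff_totalD, map_zero]

/-- The generating series `∑ k, b k z ^ k` of the Lenard sequence. -/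
def lenardSeries : PowerSeries DiffPoly := PowerSeries.mk lenard

/-- The function `κ` as a constant power series. -/
def kappaSeries : PowerSeries DiffPoly := C (MvPolynomial.X 0)

theorem map_constantCoeff_lenardSeries :
    PowerSeries.map MvPolynomial.constantCoeff lenardSeries = 1 := by
  ext1 n
  rw [coeff_map, lenardSeries, coeff_mk, coeff_one]
  cases n with
  | zero => simp [lenard]
  | succ n => simp [constantCoeff_lenard_succ]

theorem seriesD_lenardSeries :
    2 * seriesD lenardSeries = X * (seriesD (seriesD (seriesD lenardSeries)) +
      4 * kappaSeries * seriesD lenardSeries + 2 * seriesD kappaSeries * lenardSeries) := by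
  have h2 : (2 : PowerSeries DiffPoly) = C 2 := (map_ofNat C 2).symm
  have h4 : (4 : PowerSeries DiffPoly) = C 4 := (map_ofNat C 4).symm
  rw [h2, h4, kappaSeries, seriesD_C]
  ext1 n
  cases n with
  | zero => simp [coeff_zero_X_mul, coeff_C_mul, coeff_seriesD, lenardSeries, lenard,
      -coeff_zero_eq_constantCoeff]
  | succ n =>
    rw [coeff_succ_X_mul]
    simp only [map_add, mul_assoc, coeff_C_mul, coeff_seriesD, lenardSeries, coeff_mk,
      totalD_lenard_succ, formalOmegaD, totalD_X, MvPolynomial.smul_eq_C_mul]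
    have h : (MvPolynomial.C (1 / 2 : ℝ) : DiffPoly) * 2 = 1 := by
      rw [← map_ofNat MvPolynomial.C 2, ← map_mul]; norm_num
    linear_combination totalD (totalD (totalD (lenard n))) * h

/-- The first integral of the Lenard recursion: `B² - z (B B'' - B'² / 2 + 2 κ B²) = 1`
(multiplied by `2`). -/
theorem lenardSeries_relation :
    2 * lenardSeries * lenardSeries - X * (2 * lenardSeries * seriesD (seriesD lenardSeries) -
      seriesD lenardSeries * seriesD lenardSeries +
        4 * kappaSeries * lenardSeries * lenardSeries) = 2 := by
  have h2 : seriesD (2 : PowerSeries DiffPoly) = 0 := by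
    have := seriesD.map_natCast 2; simpa using this
  have h4 : seriesD (4 : PowerSeries DiffPoly) = 0 := by
    have := seriesD.map_natCast 4; simpa using this
  refine eq_of_seriesD_eq ?_ ?_
  · simp only [map_sub, map_add, Derivation.leibniz, smul_eq_mul, h2, h4, seriesD_X]
    linear_combination 2 * lenardSeries * seriesD_lenardSeries
  · simp only [map_sub, map_add, map_mul, map_constantCoeff_seriesD,
      map_constantCoeff_lenardSeries, kappaSeries, PowerSeries.map_C,
      MvPolynomial.constantCoeff_X, map_zero, map_ofNat]
    simp

/-! ### The variational derivatives of the Lenard sequence -/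

/-- The bilinear extension of `adj` to power series. -/
def seriesAdj (f g : PowerSeries DiffPoly) : PowerSeries DiffPoly :=
  PowerSeries.mk fun n =>
    ∑ x ∈ Finset.HasAntidiagonal.antidiagonal n, adj (coeff x.1 f) (coeff x.2 g)

theorem seriesAdj_add_left (f g h : PowerSeries DiffPoly) :
    seriesAdj (f + g) h = seriesAdj f h + seriesAdj g h := by
  ext1 n
  simp only [seriesAdj, coeff_mk, map_add, adj_add_left, Finset.sum_add_distrib]

theorem seriesAdj_add_right (f g h : PowerSeries DiffPoly) :
    seriesAdj f (g + h) = seriesAdj f g + seriesAdj f h := by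
  ext1 n
  simp only [seriesAdj, coeff_mk, map_add, adj_add_right, Finset.sum_add_distrib]

theorem seriesAdj_seriesD (f g : PowerSeries DiffPoly) :
    seriesAdj (seriesD f) g = -seriesAdj f (seriesD g) := by
  ext1 n
  simp only [seriesAdj, coeff_mk, map_neg, coeff_seriesD, adj_totalD, Finset.sum_neg_distrib]

theorem adj_zero_right (p : DiffPoly) : adj p 0 = 0 := by
  have := adj_add_right p 0 0
  simpa using this

theorem adj_zero_left (p : DiffPoly) : adj 0 p = 0 := by
  simpa using adj_C 0 p

theorem adj_sum_left {ι : Type*} (s : Finset ι) (f : ι → DiffPoly) (r : DiffPoly) :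
    adj (∑ i ∈ s, f i) r = ∑ i ∈ s, adj (f i) r :=
  map_sum (AddMonoidHom.mk' (fun p => adj p r) fun p q => adj_add_left p q r) f s

theorem adj_sum_right {ι : Type*} (s : Finset ι) (f : ι → DiffPoly) (p : DiffPoly) :
    adj p (∑ i ∈ s, f i) = ∑ i ∈ s, adj p (f i) :=
  map_sum (AddMonoidHom.mk' (fun r => adj p r) fun q r => adj_add_right p q r) f s

theorem sum_antidiagonal_triple (n : ℕ) (F : ℕ → ℕ → ℕ → DiffPoly) :
    ∑ x ∈ Finset.HasAntidiagonal.antidiagonal n,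
        ∑ y ∈ Finset.HasAntidiagonal.antidiagonal x.1, F y.1 y.2 x.2 =
      ∑ x ∈ Finset.HasAntidiagonal.antidiagonal n,
        ∑ y ∈ Finset.HasAntidiagonal.antidiagonal x.2, F x.1 y.1 y.2 := by
  rw [Finset.sum_sigma', Finset.sum_sigma']
  refine Finset.sum_nbij' (fun z => ⟨(z.2.1, z.2.2 + z.1.2), (z.2.2, z.1.2)⟩)
    (fun z => ⟨(z.1.1 + z.2.1, z.2.2), (z.1.1, z.2.1)⟩) ?_ ?_ ?_ ?_ ?_
  all_goals
    rintro ⟨⟨a, b⟩, ⟨c, d⟩⟩ h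
    simp only [Finset.mem_sigma, Finset.HasAntidiagonal.mem_antidiagonal] at h
    obtain ⟨h1, h2⟩ := h
    subst h1
    subst h2
    simp [add_assoc]

/-- The adjoint form of the Leibniz rule. -/
theorem seriesAdj_mul (f g h : PowerSeries DiffPoly) :
    seriesAdj (f * g) h = seriesAdj f (g * h) + seriesAdj g (f * h) := by
  ext1 n
  simp only [seriesAdj, coeff_mk, map_add, coeff_mul, adj_sum_left, adj_sum_right, adj_mul,
    Finset.sum_add_distrib]
  congr 1
  · exact sum_antidiagonal_triple n
      fun a b c => adj (coeff a f) (coeff b g * coeff c h)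
  · rw [← sum_antidiagonal_triple n
      fun a b c => adj (coeff a g) (coeff b f * coeff c h)]
    refine Finset.sum_congr rfl fun x _ => ?_
    rw [← Finset.Nat.sum_antidiagonal_swap]
    rfl

theorem seriesAdj_eq_zero {f : PowerSeries DiffPoly} (hf : ∀ n, ∃ c, coeff n f = MvPolynomial.C c)
    (g : PowerSeries DiffPoly) : seriesAdj f g = 0 := by
  ext1 n
  simp only [seriesAdj, coeff_mk, map_zero]
  refine Finset.sum_eq_zero fun x _ => ?_
  obtain ⟨c, hc⟩ := hf x.1
  rw [hc, adj_C]

theorem seriesAdj_X (g : PowerSeries DiffPoly) : seriesAdj X g = 0 :=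
  seriesAdj_eq_zero (fun n => by
    rw [coeff_X]; split_ifs
    exacts [⟨1, (map_one _).symm⟩, ⟨0, (map_zero _).symm⟩]) g

theorem seriesAdj_natCast (m : ℕ) (g : PowerSeries DiffPoly) : seriesAdj m g = 0 :=
  seriesAdj_eq_zero (fun n => by
    rw [← map_natCast C m, coeff_C]; split_ifs
    exacts [⟨m, (map_natCast _ m).symm⟩, ⟨0, (map_zero _).symm⟩]) g

theorem seriesAdj_kappaSeries (g : PowerSeries DiffPoly) : seriesAdj kappaSeries g = g := by
  ext1 n
  rw [seriesAdj, coeff_mk, Finset.sum_eq_single (0, n)]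
  · simp [kappaSeries, adj_X_zero]
  · rintro ⟨i, j⟩ hij hne
    have hi : i ≠ 0 := by
      rintro rfl
      simp at hij
      exact hne (by simp [hij])
    simp [kappaSeries, coeff_C, hi, adj_zero_left]
  · simp

theorem seriesAdj_sub_left (f g h : PowerSeries DiffPoly) :
    seriesAdj (f - g) h = seriesAdj f h - seriesAdj g h := by
  rw [eq_sub_iff_add_eq, ← seriesAdj_add_left, sub_add_cancel]

theorem seriesAdj_sub_right (f g h : PowerSeries DiffPoly) :
    seriesAdj f (g - h) = seriesAdj f g - seriesAdj f h := by
  rw [eq_sub_iff_add_eq, ← seriesAdj_add_right, sub_add_cancel]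

/-- The linearization of the relation for the generating series `B`, in adjoint form: the adjoint of
the linearization of `B` maps `L† r` to `4 z B² r`, where `L†` is the adjoint of the linearization of
the relation with respect to `B`. -/
theorem seriesAdj_lenardSeries (r : PowerSeries DiffPoly) :
    seriesAdj lenardSeries (4 * lenardSeries * r -
      X * (2 * seriesD (seriesD lenardSeries) * r +
        seriesD (seriesD (2 * lenardSeries * r)) + 2 * seriesD (seriesD lenardSeries * r) +
          8 * kappaSeries * lenardSeries * r)) =
      4 * X * lenardSeries * lenardSeries * r := by
  have h2 : ∀ g, seriesAdj 2 g = 0 := fun g => mod_cast seriesAdj_natCast 2 g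
  have h4 : ∀ g, seriesAdj 4 g = 0 := fun g => mod_cast seriesAdj_natCast 4 g
  have h := h2 r
  rw [← lenardSeries_relation] at h
  simp only [seriesAdj_sub_left, seriesAdj_add_left, seriesAdj_mul, h2, h4, seriesAdj_X,
    seriesAdj_kappaSeries, seriesAdj_seriesD, zero_add] at h
  have hX : ∀ f, X * seriesD f = seriesD (X * f) := by
    intro f; rw [Derivation.leibniz]; simp
  have e : 4 * lenardSeries * r -
      X * (2 * seriesD (seriesD lenardSeries) * r +
        seriesD (seriesD (2 * lenardSeries * r)) + 2 * seriesD (seriesD lenardSeries * r) +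
          8 * kappaSeries * lenardSeries * r) =
      2 * (lenardSeries * r) + 2 * lenardSeries * r -
        (2 * (seriesD (seriesD lenardSeries) * (X * r)) +
          seriesD (seriesD (2 * lenardSeries * (X * r))) +
          seriesD (seriesD lenardSeries * (X * r)) + seriesD (seriesD lenardSeries * (X * r)) +
          4 * kappaSeries * (lenardSeries * (X * r)) +
          4 * kappaSeries * lenardSeries * (X * r)) := by
    rw [show 2 * lenardSeries * (X * r) = X * (2 * lenardSeries * r) by ring,
      show seriesD lenardSeries * (X * r) = X * (seriesD lenardSeries * r) by ring,
      ← hX, ← hX, ← hX]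
    ring
  rw [e]
  simp only [seriesAdj_sub_right, seriesAdj_add_right]
  linear_combination h

/-- The `z`-derivative of the relation, multiplied by `2 z`: the linearization of the relation at
`2 z ∂_z B` (with `κ` fixed). -/
theorem derivative_lenardSeries_relation :
    2 * X * (4 * lenardSeries * d⁄dX DiffPoly lenardSeries -
      X * (2 * d⁄dX DiffPoly lenardSeries * seriesD (seriesD lenardSeries) +
        2 * lenardSeries * seriesD (seriesD (d⁄dX DiffPoly lenardSeries)) -
        2 * seriesD lenardSeries * seriesD (d⁄dX DiffPoly lenardSeries) +
        8 * kappaSeries * lenardSeries * d⁄dX DiffPoly lenardSeries)) =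
    2 * (2 * lenardSeries * lenardSeries - 2) := by
  have h := congrArg (d⁄dX DiffPoly) lenardSeries_relation
  have h2 : d⁄dX DiffPoly (2 : PowerSeries DiffPoly) = 0 := by
    have := (d⁄dX DiffPoly).map_natCast 2; simpa using this
  have h4 : d⁄dX DiffPoly (4 : PowerSeries DiffPoly) = 0 := by
    have := (d⁄dX DiffPoly).map_natCast 4; simpa using this
  have hk : d⁄dX DiffPoly kappaSeries = 0 := derivative_C
  simp only [map_sub, map_add, Derivation.leibniz, smul_eq_mul, h2, h4, hk, derivative_X,
    derivative_seriesD] at h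
  linear_combination 2 * X * h - 2 * lenardSeries_relation

/-- The generating function of the variational derivatives: `δB/δκ = z (2 z ∂_z + 1) B`. -/
theorem seriesAdj_lenardSeries_one :
    seriesAdj lenardSeries 1 = X * (2 * X * d⁄dX DiffPoly lenardSeries + lenardSeries) := by
  set w := 2 * X * d⁄dX DiffPoly lenardSeries + lenardSeries with hw
  have hB : PowerSeries.constantCoeff lenardSeries = 1 := by
    rw [← coeff_zero_eq_constantCoeff_apply, lenardSeries, coeff_mk, lenard]
  have hunit : IsUnit (2 * lenardSeries * lenardSeries) := by
    rw [PowerSeries.isUnit_iff_constantCoeff, map_mul, map_mul, hB, map_ofNat]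
    refine IsUnit.of_mul_eq_one (MvPolynomial.C (1 / 2 : ℝ)) ?_
    rw [← map_ofNat MvPolynomial.C 2, mul_one, mul_one, ← map_mul]; norm_num
  -- `r = w / (2 B²)` solves the adjoint linearized equation with right-hand side `2`
  obtain ⟨r, hr⟩ : ∃ r, 2 * lenardSeries * lenardSeries * r = w :=
    ⟨hunit.unit⁻¹ * w, by rw [← mul_assoc]; simp⟩
  have h2 : seriesD (2 : PowerSeries DiffPoly) = 0 := by
    have := seriesD.map_natCast 2; simpa using this
  have hD : seriesD w = 2 * X * seriesD (d⁄dX DiffPoly lenardSeries) + seriesD lenardSeries := by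
    rw [hw]; simp [Derivation.leibniz, h2]
  have hDD : seriesD (seriesD w) =
      2 * X * seriesD (seriesD (d⁄dX DiffPoly lenardSeries)) +
        seriesD (seriesD lenardSeries) := by
    rw [hD]; simp [Derivation.leibniz, h2]
  -- the linearization of the relation at `w = (2 z ∂_z + 1) B`
  have hL : 4 * lenardSeries * w - X * (2 * w * seriesD (seriesD lenardSeries) +
      2 * lenardSeries * seriesD (seriesD w) - 2 * seriesD lenardSeries * seriesD w +
        8 * kappaSeries * lenardSeries * w) = 4 * lenardSeries * lenardSeries := by
    rw [hDD, hD, hw]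
    linear_combination derivative_lenardSeries_relation + 2 * lenardSeries_relation
  -- substituting `w = 2 B² r` turns the linearization at `w` into `2 B²` times its adjoint at `r`
  have hone : 4 * lenardSeries * r -
      X * (2 * seriesD (seriesD lenardSeries) * r +
        seriesD (seriesD (2 * lenardSeries * r)) + 2 * seriesD (seriesD lenardSeries * r) +
          8 * kappaSeries * lenardSeries * r) = 2 := by
    refine hunit.mul_left_cancel ?_
    rw [← hr] at hL
    simp only [map_add, Derivation.leibniz, smul_eq_mul, h2] at hL ⊢
    linear_combination hL
  have h := seriesAdj_lenardSeries r
  rw [hone, ← one_add_one_eq_two, seriesAdj_add_right] at h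
  refine (IsUnit.of_mul_eq_one (C (MvPolynomial.C (1 / 2 : ℝ))) ?_ :
    IsUnit (2 : PowerSeries DiffPoly)).mul_left_cancel ?_
  · rw [← map_ofNat C 2, ← map_ofNat MvPolynomial.C 2, ← map_mul, ← map_mul]; norm_num
  · linear_combination h + 2 * X * hr

/-- The variational derivative of `b (n + 1)` is `(2 n + 1) b n`. -/
theorem varDeriv_lenard_succ (n : ℕ) :
    varDeriv (lenard (n + 1)) = (2 * n + 1 : ℝ) • lenard n := by
  have h := congrArg (coeff (n + 1)) seriesAdj_lenardSeries_one
  rw [coeff_succ_X_mul, seriesAdj, coeff_mk, Finset.sum_eq_single (n + 1, 0)] at h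
  · rw [varDeriv_eq_adj_one]
    have h1 : coeff n (2 * X * d⁄dX DiffPoly lenardSeries) = 2 * n * lenard n := by
      rw [mul_assoc, ← map_ofNat C 2, coeff_C_mul]
      cases n with
      | zero => simp
      | succ n =>
        rw [coeff_succ_X_mul, coeff_derivative, lenardSeries, coeff_mk]
        push_cast
        ring
    rw [map_add, h1] at h
    simp only [lenardSeries, coeff_mk, coeff_zero_one] at h
    have h2 : (MvPolynomial.C (2 : ℝ) : DiffPoly) = 2 := map_ofNat _ 2
    rw [h, MvPolynomial.smul_eq_C_mul, map_add, map_mul, h2, map_natCast, map_one]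
    ring
  · rintro ⟨i, j⟩ hij hne
    rw [Finset.HasAntidiagonal.mem_antidiagonal] at hij
    have hj : j ≠ 0 := by
      rintro rfl
      exact hne (by simpa using hij)
    simp [coeff_one, hj, adj_zero_right]
  · simp

/-! ### The KdV densities -/

theorem adj_smul_left (c : ℝ) (p r : DiffPoly) : adj (c • p) r = c • adj p r := by
  rw [MvPolynomial.smul_eq_C_mul, adj_mul, adj_C, zero_add]
  have : ∀ i, (⇑totalD)^[i] (MvPolynomial.pderiv i p * (MvPolynomial.C c * r)) =
      c • (⇑totalD)^[i] (MvPolynomial.pderiv i p * r) := by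
    intro i
    rw [← iterate_totalD_smul, MvPolynomial.smul_eq_C_mul]
    congr 1; ring
  simp only [adj, this, Finset.smul_sum, smul_comm c]

theorem isKdVDensity_lenard (n : ℕ) :
    IsKdVDensity (n + 2) ((2 * (n + 1 : ℕ) + 1 : ℝ)⁻¹ • lenard (n + 2)) := by
  have h : varDeriv ((2 * (n + 1 : ℕ) + 1 : ℝ)⁻¹ • lenard (n + 2)) = lenard (n + 1) := by
    rw [varDeriv_eq_adj_one, adj_smul_left, ← varDeriv_eq_adj_one, varDeriv_lenard_succ, smul_smul,
      inv_mul_cancel₀ (by positivity), one_smul]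
  refine ⟨?_, ?_, ?_⟩
  · rw [MvPolynomial.smul_eq_C_mul, map_mul, constantCoeff_lenard_succ, mul_zero]
  · rw [h, constantCoeff_lenard_succ]
  · rw [h, formalOmega_iterate]

theorem isKdVDensity_kdvDensity {k : ℕ} (hk : 1 ≤ k) : IsKdVDensity k (kdvDensity k) := by
  have h : ∃ p : DiffPoly, IsKdVDensity k p := by
    match k, hk with
    | 1, _ => exact ⟨_, rfl⟩
    | n + 2, _ => exact ⟨_, isKdVDensity_lenard n⟩
  rw [kdvDensity, dif_pos h]
  exact h.choose_spec

/-- Every choice of the density `h_{n+1}` has the variational derivative `b n`. -/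
theorem varDeriv_kdvDensity_succ (n : ℕ) : varDeriv (kdvDensity (n + 1)) = lenard n := by
  have h := isKdVDensity_kdvDensity (Nat.succ_le_succ (Nat.zero_le n))
  cases n with
  | zero =>
    have h' : kdvDensity 1 = MvPolynomial.X 0 := h
    rw [h', varDeriv_eq_adj_one, adj_X_zero, lenard]
  | succ n =>
    obtain ⟨-, h1, h2⟩ := h
    exact eq_of_totalD_eq (h2.trans (formalOmega_iterate n))
      (h1.trans (constantCoeff_lenard_succ n).symm)

end Series

/-! ### Calculus on the circle -/

section Circle

variable {E : Type*} [NormedAddCommGroup E] [NormedSpace ℝ E]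

theorem IsSmooth.hasDerivAt_coe {f : S1 → E} (hf : IsSmooth f) (s : ℝ) :
    HasDerivAt (fun t : ℝ => f (t : S1)) (KdVCurve.dS f (s : S1)) s := by
  rw [dS_coe]
  exact (hf.differentiable (by simp) s).hasDerivAt

theorem IsSmooth.hasDerivAt {f : S1 → E} (hf : IsSmooth f) (x : S1) :
    HasDerivAt (fun t : ℝ => f (x + (t : S1))) (KdVCurve.dS f x) 0 := by
  induction x using QuotientAddGroup.induction_on with
  | H s =>
    have h := HasDerivAt.comp_const_add s 0 (by simpa using hf.hasDerivAt_coe s)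
    refine h.congr_of_eventuallyEq (Filter.Eventually.of_forall fun t => ?_)
    change f ((s : S1) + (t : S1)) = f ((s + t : ℝ) : S1)
    rw [AddCircle.coe_add]

theorem dS_eq_of_hasDerivAt {f : S1 → E} {x : S1} {v : E}
    (h : HasDerivAt (fun t : ℝ => f (x + (t : S1))) v 0) : dS f x = v := h.deriv

theorem isSmooth_const (c : E) : IsSmooth (fun _ : S1 => c) := contDiff_const

theorem dS_const (c : E) : dS (fun _ : S1 => c) = fun _ => 0 :=
  funext fun _ => dS_eq_of_hasDerivAt (hasDerivAt_const _ _)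

theorem IsSmooth.iterate_dS {f : S1 → E} (hf : IsSmooth f) (i : ℕ) :
    IsSmooth (KdVCurve.dS^[i] f) := by
  induction i with
  | zero => exact hf
  | succ i ih => rw [Function.iterate_succ_apply']; exact ih.dS

theorem dS_mul {f g : S1 → ℝ} (hf : IsSmooth f) (hg : IsSmooth g) (x : S1) :
    dS (fun s => f s * g s) x = dS f x * g x + f x * dS g x :=
  dS_eq_of_hasDerivAt (((hf.hasDerivAt x).mul (hg.hasDerivAt x)).congr_deriv (by simp))

theorem IsSmooth.intervalIntegrable {f : S1 → ℝ} (hf : IsSmooth f) (a b : ℝ) :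
    IntervalIntegrable (fun s : ℝ => f (s : S1)) MeasureTheory.volume a b :=
  hf.continuous.intervalIntegrable a b

theorem periodic_coe {F : Type*} (f : S1 → F) :
    Function.Periodic (fun s : ℝ => f (s : S1)) (2 * Real.pi) := fun s => by
  change f ((s + 2 * Real.pi : ℝ) : S1) = f (s : S1)
  rw [AddCircle.coe_add_period]

theorem integralS1_dS {f : S1 → ℝ} (hf : IsSmooth f) : integralS1 (dS f) = 0 := by
  rw [integralS1, intervalIntegral.integral_eq_sub_of_hasDerivAt
    (fun s _ => hf.hasDerivAt_coe s) (hf.dS.intervalIntegrable _ _)]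
  have := periodic_coe f 0
  simp only [zero_add] at this
  rw [this, sub_self]

theorem integralS1_add {f g : S1 → ℝ} (hf : IsSmooth f) (hg : IsSmooth g) :
    integralS1 (fun s => f s + g s) = integralS1 f + integralS1 g :=
  intervalIntegral.integral_add (hf.intervalIntegrable _ _) (hg.intervalIntegrable _ _)

theorem integralS1_const_mul (c : ℝ) (f : S1 → ℝ) :
    integralS1 (fun s => c * f s) = c * integralS1 f :=
  intervalIntegral.integral_const_mul c _

theorem IsSmooth.mul {f g : S1 → ℝ} (hf : IsSmooth f) (hg : IsSmooth g) :
    IsSmooth (fun s => f s * g s) := ContDiff.mul hf hg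

theorem IsSmooth.add {f g : S1 → E} (hf : IsSmooth f) (hg : IsSmooth g) :
    IsSmooth (fun s => f s + g s) := ContDiff.add hf hg

theorem IsSmooth.smul {f : S1 → ℝ} {g : S1 → E} (hf : IsSmooth f) (hg : IsSmooth g) :
    IsSmooth (fun s => f s • g s) := ContDiff.smul hf hg

/-- Integration by parts on the circle. -/
theorem integralS1_mul_dS {f g : S1 → ℝ} (hf : IsSmooth f) (hg : IsSmooth g) :
    integralS1 (fun s => f s * dS g s) = -integralS1 (fun s => dS f s * g s) := by
  have h := integralS1_dS (hf.mul hg)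
  rw [show dS (fun s => f s * g s) = fun s => dS f s * g s + f s * dS g s from
    funext (dS_mul hf hg), integralS1_add (hf.dS.mul hg) (hf.mul hg.dS)] at h
  linarith

theorem integralS1_mul_iterate_dS {f g : S1 → ℝ} (hf : IsSmooth f) (hg : IsSmooth g) (i : ℕ) :
    integralS1 (fun s => f s * dS^[i] g s) =
      (-1) ^ i * integralS1 (fun s => dS^[i] f s * g s) := by
  induction i generalizing g with
  | zero => simp
  | succ i ih =>
    rw [Function.iterate_succ_apply, ih hg.dS, Function.iterate_succ_apply',
      integralS1_mul_dS (hf.iterate_dS i) hg]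
    ring

theorem integralS1_sum {ι : Type*} (s : Finset ι) {f : ι → S1 → ℝ}
    (hf : ∀ i ∈ s, IsSmooth (f i)) :
    integralS1 (fun x => ∑ i ∈ s, f i x) = ∑ i ∈ s, integralS1 (f i) :=
  intervalIntegral.integral_finsetSum fun i hi => (hf i hi).intervalIntegrable _ _

/-- A smooth function on the circle with integral zero has a smooth primitive on the circle. -/
theorem exists_dS_eq {f : S1 → ℝ} (hf : IsSmooth f) (h0 : integralS1 f = 0) :
    ∃ F : S1 → ℝ, IsSmooth F ∧ dS F = f := by
  set G : ℝ → ℝ := fun t => ∫ s in (0 : ℝ)..t, f (s : S1) with hG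
  have hint := fun a b => hf.intervalIntegrable a b
  have hper : Function.Periodic G (2 * Real.pi) := by
    intro t
    have h1 := intervalIntegral.integral_add_adjacent_intervals (hint 0 t) (hint t (t + 2 * Real.pi))
    have h2 := (periodic_coe f).intervalIntegral_add_eq t 0
    rw [zero_add] at h2
    simp only [hG]
    rw [← h1, h2]
    have h3 : ∫ s in (0 : ℝ)..(2 * Real.pi), f (s : S1) = 0 := h0
    rw [h3, add_zero]
  have hder : ∀ t : ℝ, HasDerivAt G (f (t : S1)) t := fun t =>
    intervalIntegral.integral_hasDerivAt_right (hint 0 t)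
      (hf.continuous.stronglyMeasurableAtFilter _ _) hf.continuous.continuousAt
  have hcoe : (fun s : ℝ => hper.lift (s : S1)) = G := funext fun s => hper.lift_coe s
  refine ⟨hper.lift, ?_, ?_⟩
  · rw [IsSmooth, hcoe, contDiff_infty_iff_deriv]
    refine ⟨fun t => (hder t).differentiableAt, ?_⟩
    rw [show deriv G = fun t : ℝ => f (t : S1) from funext fun t => (hder t).deriv]
    exact hf
  · funext x
    induction x using QuotientAddGroup.induction_on with
    | H s =>
      rw [dS_coe, hcoe, (hder s).deriv]

/-! ### Smooth families on the circle -/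

/-- A family `F t` of maps on the circle that is smooth in `(t, s)` jointly. -/
def IsSmoothFamily (F : ℝ → S1 → E) : Prop :=
  ContDiff ℝ ∞ (fun p : ℝ × ℝ => F p.1 (p.2 : S1))

/-- The derivative of a family with respect to the parameter. -/
def dT (F : ℝ → S1 → E) : ℝ → S1 → E := fun t x => deriv (fun t' => F t' x) t

theorem IsSmoothFamily.isSmooth {F : ℝ → S1 → E} (hF : IsSmoothFamily F) (t : ℝ) :
    IsSmooth (F t) :=
  ContDiff.comp (g := fun p : ℝ × ℝ => F p.1 (p.2 : S1)) hF (contDiff_const.prodMk contDiff_id)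

theorem IsSmoothFamily.dS_coe_eq {F : ℝ → S1 → E} (hF : IsSmoothFamily F) (t s : ℝ) :
    dS (F t) (s : S1) = fderiv ℝ (fun p : ℝ × ℝ => F p.1 (p.2 : S1)) (t, s) (0, 1) := by
  rw [dS_coe]
  have h := (hF.differentiable (by simp) (t, s)).hasFDerivAt.comp_hasDerivAt s
    ((hasDerivAt_const s t).prodMk (hasDerivAt_id s))
  exact h.deriv

theorem IsSmoothFamily.hasDerivAt_coe {F : ℝ → S1 → E} (hF : IsSmoothFamily F) (t s : ℝ) :
    HasDerivAt (fun t' => F t' (s : S1))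
      (fderiv ℝ (fun p : ℝ × ℝ => F p.1 (p.2 : S1)) (t, s) (1, 0)) t := by
  have h := (hF.differentiable (by simp) (t, s)).hasFDerivAt.comp_hasDerivAt t
    ((hasDerivAt_id t).prodMk (hasDerivAt_const t s))
  exact h

theorem IsSmoothFamily.hasDerivAt {F : ℝ → S1 → E} (hF : IsSmoothFamily F) (t : ℝ) (x : S1) :
    HasDerivAt (fun t' => F t' x) (dT F t x) t := by
  induction x using QuotientAddGroup.induction_on with
  | H s => exact (hF.hasDerivAt_coe t s).differentiableAt.hasDerivAt

theorem IsSmoothFamily.dS {F : ℝ → S1 → E} (hF : IsSmoothFamily F) :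
    IsSmoothFamily (fun t => dS (F t)) := by
  unfold IsSmoothFamily
  simp only [hF.dS_coe_eq]
  exact (hF.fderiv_right (m := ∞) (by simp)).clm_apply contDiff_const

theorem IsSmoothFamily.dT {F : ℝ → S1 → E} (hF : IsSmoothFamily F) : IsSmoothFamily (dT F) := by
  unfold IsSmoothFamily
  have : (fun p : ℝ × ℝ => KdVCurve.dT F p.1 (p.2 : S1)) =
      fun p => fderiv ℝ (fun p : ℝ × ℝ => F p.1 (p.2 : S1)) p (1, 0) :=
    funext fun p => (hF.hasDerivAt_coe p.1 p.2).deriv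
  rw [this]
  exact (hF.fderiv_right (m := ∞) (by simp)).clm_apply contDiff_const

theorem IsSmoothFamily.dT_dS {F : ℝ → S1 → E} (hF : IsSmoothFamily F) (t : ℝ) :
    KdVCurve.dT (fun t => KdVCurve.dS (F t)) t = KdVCurve.dS (KdVCurve.dT F t) := by
  funext x
  induction x using QuotientAddGroup.induction_on with
  | H s =>
    rw [hF.dT.dS_coe_eq, KdVCurve.dT, (hF.dS.hasDerivAt_coe t s).deriv]
    have h1 : (fun p : ℝ × ℝ => KdVCurve.dT F p.1 (p.2 : S1)) =
        fun p => fderiv ℝ (fun p : ℝ × ℝ => F p.1 (p.2 : S1)) p (1, 0) :=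
      funext fun p => (hF.hasDerivAt_coe p.1 p.2).deriv
    have h2 : (fun p : ℝ × ℝ => KdVCurve.dS (F p.1) (p.2 : S1)) =
        fun p => fderiv ℝ (fun p : ℝ × ℝ => F p.1 (p.2 : S1)) p (0, 1) :=
      funext fun p => hF.dS_coe_eq p.1 p.2
    rw [h1, h2]
    have hd : DifferentiableAt ℝ (fderiv ℝ (fun p : ℝ × ℝ => F p.1 (p.2 : S1))) (t, s) :=
      (hF.fderiv_right (m := ∞) (by simp)).differentiable (by simp) _
    rw [fderiv_clm_apply hd (differentiableAt_const _),
      fderiv_clm_apply hd (differentiableAt_const _)]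
    have hsymm : IsSymmSndFDerivAt ℝ (fun p : ℝ × ℝ => F p.1 (p.2 : S1)) (t, s) :=
      hF.contDiffAt.isSymmSndFDerivAt (by
        rw [minSmoothness_of_isRCLikeNormedField]
        exact WithTop.coe_le_coe.2 (le_top : (2 : ℕ∞) ≤ ⊤))
    simpa using hsymm.eq (1, 0) (0, 1)

theorem IsSmoothFamily.iterate_dS {F : ℝ → S1 → E} (hF : IsSmoothFamily F) (i : ℕ) :
    IsSmoothFamily (fun t => KdVCurve.dS^[i] (F t)) := by
  induction i with
  | zero => exact hF
  | succ i ih => simp only [Function.iterate_succ_apply']; exact ih.dS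

theorem IsSmoothFamily.dT_iterate_dS {F : ℝ → S1 → E} (hF : IsSmoothFamily F) (t : ℝ) (i : ℕ) :
    KdVCurve.dT (fun t => KdVCurve.dS^[i] (F t)) t = KdVCurve.dS^[i] (KdVCurve.dT F t) := by
  induction i with
  | zero => rfl
  | succ i ih =>
    simp only [Function.iterate_succ_apply']
    rw [(hF.iterate_dS i).dT_dS, ih]

/-- Differentiation under the integral sign. -/
theorem IsSmoothFamily.hasDerivAt_integralS1 {F : ℝ → S1 → ℝ} (hF : IsSmoothFamily F) (t₀ : ℝ) :
    HasDerivAt (fun t => integralS1 (F t)) (integralS1 (KdVCurve.dT F t₀)) t₀ := by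
  obtain ⟨M, hM⟩ := ((isCompact_closedBall t₀ 1).prod
    (isCompact_uIcc (a := (0 : ℝ)) (b := 2 * Real.pi))).exists_bound_of_continuousOn
      hF.dT.continuous.continuousOn
  refine (intervalIntegral.hasDerivAt_integral_of_dominated_loc_of_deriv_le
    (F := fun t (s : ℝ) => F t (s : S1)) (F' := fun t (s : ℝ) => KdVCurve.dT F t (s : S1))
    (bound := fun _ => M) (Metric.ball_mem_nhds t₀ one_pos) ?_ ?_ ?_ ?_ ?_ ?_).2
  · exact Filter.Eventually.of_forall fun t => (hF.isSmooth t).continuous.aestronglyMeasurable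
  · exact (hF.isSmooth t₀).intervalIntegrable _ _
  · exact (hF.dT.isSmooth t₀).continuous.aestronglyMeasurable
  · exact Filter.Eventually.of_forall fun s hs t ht =>
      hM (t, s) ⟨Metric.ball_subset_closedBall ht, Set.uIoc_subset_uIcc hs⟩
  · exact intervalIntegrable_const
  · exact Filter.Eventually.of_forall fun s _ t _ => hF.hasDerivAt t _

end Circle

/-! ### Differential polynomials as functionals -/

/-- The value `p(κ, κ_s, κ_ss, …)` of a differential polynomial at a function on the circle. -/
def evalDiff (κ : S1 → ℝ) (p : DiffPoly) : S1 → ℝ :=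
  fun s => MvPolynomial.eval (fun i => dS^[i] κ s) p

theorem hamiltonian_eq (n : ℕ) (γ : S1 → Plane) :
    hamiltonian n γ = integralS1 (evalDiff (curvature γ) (kdvDensity n)) := rfl

/-- The chain rule for a polynomial, expressed by a derivation of the polynomial ring. -/
theorem hasDerivAt_eval (d : Derivation ℝ DiffPoly DiffPoly) (f : ℕ → ℝ → ℝ) (t : ℝ)
    (hf : ∀ i, HasDerivAt (f i)
      (MvPolynomial.eval (fun j => f j t) (d (MvPolynomial.X i))) t) (p : DiffPoly) :
    HasDerivAt (fun t' => MvPolynomial.eval (fun j => f j t') p)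
      (MvPolynomial.eval (fun j => f j t) (d p)) t := by
  induction p using MvPolynomial.induction_on with
  | C a => simpa using hasDerivAt_const t a
  | add p q hp hq =>
    simp only [map_add]
    exact hp.add hq
  | mul_X p i hp =>
    simp only [map_mul, MvPolynomial.eval_X, Derivation.leibniz, smul_eq_mul, map_add]
    refine (hp.mul (hf i)).congr_deriv ?_
    ring

theorem isSmoothFamily_evalDiff {K : ℝ → S1 → ℝ} (hK : IsSmoothFamily K) (p : DiffPoly) :
    IsSmoothFamily (fun t => evalDiff (K t) p) := by
  unfold IsSmoothFamily evalDiff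
  induction p using MvPolynomial.induction_on with
  | C a => simpa using contDiff_const
  | add p q hp hq => simpa using hp.add hq
  | mul_X p i hp => simpa using hp.mul (hK.iterate_dS i)

theorem isSmooth_evalDiff {κ : S1 → ℝ} (hκ : IsSmooth κ) (p : DiffPoly) :
    IsSmooth (evalDiff κ p) :=
  (isSmoothFamily_evalDiff (K := fun _ => κ)
    (ContDiff.comp (g := fun s : ℝ => κ (s : S1)) hκ contDiff_snd) p).isSmooth 0

theorem dS_evalDiff {κ : S1 → ℝ} (hκ : IsSmooth κ) (p : DiffPoly) :
    dS (evalDiff κ p) = evalDiff κ (totalD p) := by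
  funext x
  refine dS_eq_of_hasDerivAt ?_
  have h := hasDerivAt_eval totalD (fun i (t : ℝ) => dS^[i] κ (x + (t : S1))) 0 (fun i => by
    simpa [Function.iterate_succ_apply'] using (hκ.iterate_dS i).hasDerivAt x) p
  simpa [evalDiff] using h

theorem iterate_dS_evalDiff {κ : S1 → ℝ} (hκ : IsSmooth κ) (i : ℕ) (p : DiffPoly) :
    dS^[i] (evalDiff κ p) = evalDiff κ ((⇑totalD)^[i] p) := by
  induction i with
  | zero => rfl
  | succ i ih => rw [Function.iterate_succ_apply', ih, dS_evalDiff hκ, Function.iterate_succ_apply']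

theorem derivation_sum_apply {ι : Type*} (s : Finset ι)
    (d : ι → Derivation ℝ DiffPoly DiffPoly) (p : DiffPoly) :
    (∑ i ∈ s, d i) p = ∑ i ∈ s, d i p := by
  induction s using Finset.cons_induction with
  | empty => simp
  | cons a s ha ih => rw [Finset.sum_cons, Finset.sum_cons, Derivation.add_apply, ih]

theorem dT_evalDiff {K : ℝ → S1 → ℝ} (hK : IsSmoothFamily K) (t : ℝ) (p : DiffPoly) (x : S1) :
    dT (fun t => evalDiff (K t) p) t x =
      ∑ i ∈ p.vars, evalDiff (K t) (MvPolynomial.pderiv i p) x * dS^[i] (dT K t) x := by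
  have h := hasDerivAt_eval
    (MvPolynomial.mkDerivation ℝ fun i => MvPolynomial.C (dS^[i] (dT K t) x))
    (fun i t' => dS^[i] (K t') x) t (fun i => by
      rw [MvPolynomial.mkDerivation_X, MvPolynomial.eval_C, ← hK.dT_iterate_dS]
      exact (hK.iterate_dS i).hasDerivAt t x) p
  refine h.deriv.trans ?_
  have h2 : MvPolynomial.mkDerivation ℝ (fun i => MvPolynomial.C (dS^[i] (dT K t) x)) p =
      (∑ i ∈ p.vars, (MvPolynomial.C (dS^[i] (dT K t) x) : DiffPoly) •
        (MvPolynomial.pderiv i : Derivation ℝ DiffPoly DiffPoly)) p := by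
    refine MvPolynomial.derivation_eq_of_forall_mem_vars fun i hi => ?_
    rw [MvPolynomial.mkDerivation_X, derivation_sum_apply,
      Finset.sum_eq_single i]
    · simp
    · intro j _ hj; simp [MvPolynomial.pderiv_X, hj.symm]
    · exact fun h => absurd hi h
  rw [h2, derivation_sum_apply, map_sum]
  refine Finset.sum_congr rfl fun i _ => ?_
  rw [Derivation.smul_apply, smul_eq_mul, map_mul, MvPolynomial.eval_C, mul_comm]
  rfl

theorem evalDiff_sum_smul {ι : Type*} (s : Finset ι) (κ : S1 → ℝ) (c : ι → ℝ) (p : ι → DiffPoly)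
    (x : S1) : evalDiff κ (∑ i ∈ s, c i • p i) x = ∑ i ∈ s, c i * evalDiff κ (p i) x := by
  simp [evalDiff, MvPolynomial.smul_eval]

/-- The first variation of the functional `∫ p(κ, κ_s, …) ds`. -/
theorem hasDerivAt_integralS1_evalDiff {K : ℝ → S1 → ℝ} (hK : IsSmoothFamily K) (t : ℝ)
    (p : DiffPoly) :
    HasDerivAt (fun t => integralS1 (evalDiff (K t) p))
      (integralS1 (fun s => evalDiff (K t) (varDeriv p) s * dT K t s)) t := by
  have h := (isSmoothFamily_evalDiff hK p).hasDerivAt_integralS1 t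
  have hκ := hK.isSmooth t
  have hv := hK.dT.isSmooth t
  convert h using 1
  rw [show dT (fun t => evalDiff (K t) p) t = fun x => ∑ i ∈ p.vars,
    evalDiff (K t) (MvPolynomial.pderiv i p) x * dS^[i] (dT K t) x from
      funext (dT_evalDiff hK t p)]
  rw [integralS1_sum _ fun i _ => (isSmooth_evalDiff hκ _).mul (hv.iterate_dS i)]
  simp only [varDeriv, evalDiff_sum_smul, Finset.sum_mul, mul_assoc]
  rw [integralS1_sum _ fun i _ => (isSmooth_const _).mul ((isSmooth_evalDiff hκ _).mul hv)]
  refine Finset.sum_congr rfl fun i _ => ?_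
  rw [integralS1_const_mul, integralS1_mul_iterate_dS (isSmooth_evalDiff hκ _) hv,
    iterate_dS_evalDiff hκ]

/-! ### The first variation of the curvature -/

theorem IsSmooth.det2 {u v : S1 → Plane} (hu : IsSmooth u) (hv : IsSmooth v) :
    IsSmooth (fun s => det2 (u s) (v s)) := by
  have hu' := contDiff_pi.1 hu
  have hv' := contDiff_pi.1 hv
  unfold IsSmooth
  simp only [KdVCurve.det2, Matrix.det_fin_two, Matrix.of_apply, Matrix.cons_val_zero,
    Matrix.cons_val_one]
  exact ((hu' 0).mul (hv' 1)).sub ((hu' 1).mul (hv' 0))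

theorem IsSmoothFamily.det2 {u v : ℝ → S1 → Plane} (hu : IsSmoothFamily u)
    (hv : IsSmoothFamily v) : IsSmoothFamily (fun t s => det2 (u t s) (v t s)) := by
  have hu' := contDiff_pi.1 hu
  have hv' := contDiff_pi.1 hv
  unfold IsSmoothFamily
  simp only [KdVCurve.det2, Matrix.det_fin_two, Matrix.of_apply, Matrix.cons_val_zero,
    Matrix.cons_val_one]
  exact ((hu' 0).mul (hv' 1)).sub ((hu' 1).mul (hv' 0))

theorem hasDerivAt_det2 {u v : ℝ → Plane} {u' v' : Plane} {t : ℝ} (hu : HasDerivAt u u' t)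
    (hv : HasDerivAt v v' t) :
    HasDerivAt (fun t => det2 (u t) (v t)) (det2 u' (v t) + det2 (u t) v') t := by
  rw [hasDerivAt_pi] at hu hv
  simp only [det2, Matrix.det_fin_two, Matrix.of_apply, Matrix.cons_val_zero, Matrix.cons_val_one]
  refine (((hu 0).mul (hv 1)).sub ((hu 1).mul (hv 0))).congr_deriv ?_
  ring

theorem det2_frame (u v : Plane) (a b c d : ℝ) :
    det2 (a • u + b • v) (c • u + d • v) = (a * d - b * c) * det2 u v := by
  simp only [det2, Matrix.det_fin_two, Matrix.of_apply, Matrix.cons_val_zero, Matrix.cons_val_one,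
    Pi.add_apply, Pi.smul_apply, smul_eq_mul]
  ring

theorem isSmooth_curvature {γ : S1 → Plane} (hγ : IsSmooth γ) : IsSmooth (curvature γ) :=
  hγ.dS.det2 hγ.dS.dS

theorem isSmoothFamily_curvature {Γ : ℝ → S1 → Plane} (hΓ : IsSmoothFamily Γ) :
    IsSmoothFamily (fun t => curvature (Γ t)) :=
  hΓ.dS.det2 hΓ.dS.dS

theorem isSmooth_motionField {γ : S1 → Plane} (hγ : IsSmooth γ) {α : S1 → ℝ} (hα : IsSmooth α) :
    IsSmooth (motionField γ α) :=
  (((isSmooth_const _).mul hα.dS).smul hγ).add (hα.smul hγ.dS)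

theorem coord_motionField {γ : S1 → Plane} (hγ : γ ∈ curveSpace) (α : S1 → ℝ) :
    coord γ (motionField γ α) = α := by
  funext s
  have h := det2_frame (γ s) (dS γ s) 1 0 (-(1 / 2) * dS α s) (α s)
  rw [hγ.2.2 s] at h
  simpa [coord, motionField] using h

/-- The structure equation `γ_ss = -κ γ` in the moving frame `(γ, γ_s)`. -/
theorem dS_frame {γ : S1 → Plane} (hγ : γ ∈ curveSpace) {f g : S1 → ℝ} (hf : IsSmooth f)
    (hg : IsSmooth g) :
    dS (fun s => f s • γ s + g s • dS γ s) =
      fun s => (dS f s - g s * curvature γ s) • γ s + (f s + dS g s) • dS γ s := by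
  funext x
  refine dS_eq_of_hasDerivAt ((((hf.hasDerivAt x).smul (hγ.1.hasDerivAt x)).add
    ((hg.hasDerivAt x).smul (hγ.1.dS.hasDerivAt x))).congr_deriv ?_)
  rw [dS_dS_eq hγ]
  simp only [AddCircle.coe_zero, add_zero]
  module

theorem dS_const_mul {f : S1 → ℝ} (hf : IsSmooth f) (c : ℝ) :
    dS (fun s => c * f s) = fun s => c * dS f s := by
  funext x
  rw [dS_mul (isSmooth_const c) hf, dS_const]
  ring

theorem dS_add {f g : S1 → ℝ} (hf : IsSmooth f) (hg : IsSmooth g) (x : S1) :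
    dS (fun s => f s + g s) x = dS f x + dS g x :=
  dS_eq_of_hasDerivAt ((hf.hasDerivAt x).add (hg.hasDerivAt x))

/-- Along the motion `-(1/2) α_s γ + α γ_s` the curvature evolves by `κ_t = Ω D_s α`. -/
theorem curvature_variation {γ : S1 → Plane} (hγ : γ ∈ curveSpace) {α : S1 → ℝ}
    (hα : IsSmooth α) {Γ : ℝ → S1 → Plane} (hΓ : IsVariation γ (motionField γ α) Γ) :
    dT (fun t => curvature (Γ t)) 0 = omegaD (curvature γ) α := by
  obtain ⟨hs, h0, hv⟩ := hΓ
  have hF : IsSmoothFamily Γ := hs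
  have hκ := isSmooth_curvature hγ.1
  have hY : dT Γ 0 = motionField γ α := funext hv
  have h1 : dS (motionField γ α) = fun s =>
      (-(1 / 2) * dS (dS α) s + (-1) * (α s * curvature γ s)) • γ s +
        ((1 / 2) * dS α s) • dS γ s := by
    unfold motionField
    rw [dS_frame hγ ((isSmooth_const _).mul hα.dS) hα, dS_const_mul hα.dS]
    funext s
    congr 2 <;> ring
  have h2 : dS (dS (motionField γ α)) = fun s =>
      (-(1 / 2) * dS (dS (dS α)) s - 3 / 2 * curvature γ s * dS α s - dS (curvature γ) s * α s) •
        γ s + (-(curvature γ s * α s)) • dS γ s := by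
    have ha := (isSmooth_const (-(1 / 2) : ℝ)).mul hα.dS.dS
    have hb := (isSmooth_const (-1 : ℝ)).mul (hα.mul hκ)
    rw [h1, dS_frame hγ (ha.add hb) ((isSmooth_const _).mul hα.dS), dS_const_mul hα.dS]
    funext s
    rw [dS_add ha hb, dS_const_mul hα.dS.dS, dS_const_mul (hα.mul hκ)]
    simp only [dS_mul hα hκ]
    congr 2 <;> ring
  funext s
  have hd := hasDerivAt_det2 (hF.dS.hasDerivAt 0 s) (hF.dS.dS.hasDerivAt 0 s)
  refine hd.deriv.trans ?_
  rw [hF.dS.dT_dS, hF.dT_dS, hY, h2, h1, h0, dS_dS_eq hγ]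
  have e1 := det2_frame (γ s) (dS γ s)
    (-(1 / 2) * dS (dS α) s + (-1) * (α s * curvature γ s)) ((1 / 2) * dS α s)
    (-(curvature γ s)) 0
  have e2 := det2_frame (γ s) (dS γ s) 0 1
    (-(1 / 2) * dS (dS (dS α)) s - 3 / 2 * curvature γ s * dS α s - dS (curvature γ) s * α s)
    (-(curvature γ s * α s))
  rw [hγ.2.2 s] at e1 e2
  simp only [zero_smul, add_zero, zero_add, one_smul] at e1 e2
  rw [e1, e2, omegaD]
  ring

/-- The first variation of the Hamiltonians: `dH_{k+1}(X) = ∫ b_k(κ) Ω D_s α ds`, where `b_k` is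
the Lenard sequence. -/
theorem hasDifferential_hamiltonian {γ : S1 → Plane} (hγ : γ ∈ curveSpace) {α : S1 → ℝ}
    (hα : IsSmooth α) (k : ℕ) :
    HasDifferential (hamiltonian (k + 1)) γ (motionField γ α)
      (integralS1 (fun s => evalDiff (curvature γ) (lenard k) s * omegaD (curvature γ) α s)) := by
  intro Γ hΓ
  have h := hasDerivAt_integralS1_evalDiff (isSmoothFamily_curvature hΓ.1) 0 (kdvDensity (k + 1))
  rwa [varDeriv_kdvDensity_succ, curvature_variation hγ hα hΓ, hΓ.2.1] at h

theorem exists_isVariation {γ Y : S1 → Plane} (hγ : IsSmooth γ) (hY : IsSmooth Y) :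
    ∃ Γ, IsVariation γ Y Γ := by
  refine ⟨fun t s => γ s + t • Y s, ?_, ?_, fun s => ?_⟩
  · exact (ContDiff.comp (g := fun s : ℝ => γ (s : S1)) hγ contDiff_snd).add
      (contDiff_fst.smul (ContDiff.comp (g := fun s : ℝ => Y (s : S1)) hY contDiff_snd))
  · simp
  · have h := ((hasDerivAt_id (0 : ℝ)).smul_const (Y s)).const_add (γ s)
    simpa using h.deriv

/-- The tangent space of the level set in terms of the function `α`. -/
theorem mem_tangentLevelSet_iff {m : ℕ} {γ : S1 → Plane} (hγ : γ ∈ curveSpace)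
    {X : S1 → Plane} :
    X ∈ tangentLevelSet m γ ↔ ∃ α, IsSmooth α ∧ X = motionField γ α ∧ ∀ k < m,
      integralS1 (fun s => evalDiff (curvature γ) (lenard k) s * omegaD (curvature γ) α s) = 0 := by
  constructor
  · rintro ⟨⟨α, hα, rfl⟩, h⟩
    refine ⟨α, hα, rfl, fun k hk => ?_⟩
    -- a variation with velocity `X` has to exist for `HasDifferential` to carry information
    obtain ⟨Γ, hΓ⟩ := exists_isVariation hγ.1 (isSmooth_motionField hγ.1 hα)
    exact (hasDifferential_hamiltonian hγ hα k Γ hΓ).unique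
      (h (k + 1) (Nat.le_add_left 1 k) hk Γ hΓ)
  · rintro ⟨α, hα, rfl, h⟩
    refine ⟨⟨α, hα, rfl⟩, fun k hk1 hkm => ?_⟩
    obtain ⟨k, rfl⟩ : ∃ j, k = j + 1 := ⟨k - 1, by omega⟩
    rw [← h k hkm]
    exact hasDifferential_hamiltonian hγ hα k

/-! ### Recursion chains -/

theorem IsSmooth.omegaD {κ b : S1 → ℝ} (hκ : IsSmooth κ) (hb : IsSmooth b) :
    IsSmooth (omegaD κ b) :=
  (((isSmooth_const _).mul hb.dS.dS.dS).add (((isSmooth_const _).mul hκ).mul hb.dS)).add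
    (hκ.dS.mul hb)

/-- `Ω D_s` is skew-adjoint on the circle. -/
theorem integralS1_mul_omegaD {κ f g : S1 → ℝ} (hκ : IsSmooth κ) (hf : IsSmooth f)
    (hg : IsSmooth g) :
    integralS1 (fun s => f s * omegaD κ g s) = -integralS1 (fun s => omegaD κ f s * g s) := by
  set P : S1 → ℝ := fun s => (1 / 2 : ℝ) * (f s * dS (dS g) s + dS (dS f) s * g s +
    (-1) * (dS f s * dS g s)) + 2 * (κ s * (f s * g s)) with hP
  have h1 := (hf.mul hg.dS.dS).add (hf.dS.dS.mul hg)
  have h2 := (isSmooth_const (-1 : ℝ)).mul (hf.dS.mul hg.dS)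
  have h3 := (isSmooth_const (1 / 2 : ℝ)).mul (h1.add h2)
  have h4 := (isSmooth_const (2 : ℝ)).mul (hκ.mul (hf.mul hg))
  have hPs : IsSmooth P := h3.add h4
  have hd : dS P = fun s => f s * omegaD κ g s + omegaD κ f s * g s := by
    funext s
    rw [hP, dS_add h3 h4, dS_const_mul (h1.add h2), dS_const_mul (hκ.mul (hf.mul hg))]
    simp only [dS_add h1 h2, dS_add (hf.mul hg.dS.dS) (hf.dS.dS.mul hg),
      dS_const_mul (hf.dS.mul hg.dS), dS_mul hf hg.dS.dS, dS_mul hf.dS.dS hg,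
      dS_mul hf.dS hg.dS, dS_mul hκ (hf.mul hg), dS_mul hf hg, omegaD]
    ring
  have h := integralS1_dS hPs
  rw [hd, integralS1_add (hf.mul (hκ.omegaD hg)) ((hκ.omegaD hf).mul hg)] at h
  linarith

/-- Moving `Ω` from one chain to the other. -/
theorem integralS1_chain_step {κ : S1 → ℝ} (hκ : IsSmooth κ) {M N : ℕ} {α β : S1 → ℝ}
    {a b : ℕ → S1 → ℝ} (ha : IsRecursionChain κ M α a) (hb : IsRecursionChain κ N β b)
    {i j : ℕ} (hi : i < M) (hj : j < N) :
    integralS1 (fun s => a i s * omegaD κ (b (j + 1)) s) =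
      integralS1 (fun s => a (i + 1) s * omegaD κ (b j) s) := by
  rw [integralS1_mul_omegaD hκ (ha.2.1 i hi.le) (hb.2.1 (j + 1) hj), ← ha.2.2 i hi,
    ← integralS1_mul_dS (ha.2.1 (i + 1) hi) (hb.2.1 (j + 1) hj), hb.2.2 j hj]

theorem integralS1_chain {κ : S1 → ℝ} (hκ : IsSmooth κ) {M N : ℕ} {α β : S1 → ℝ}
    {a b : ℕ → S1 → ℝ} (ha : IsRecursionChain κ M α a) (hb : IsRecursionChain κ N β b)
    {j : ℕ} (hM : j ≤ M) (hN : j ≤ N) :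
    integralS1 (fun s => α s * omegaD κ (b j) s) =
      integralS1 (fun s => a j s * omegaD κ β s) := by
  suffices H : ∀ k i, i + k = j → integralS1 (fun s => a i s * omegaD κ (b k) s) =
      integralS1 (fun s => a j s * omegaD κ (b 0) s) by
    have := H j 0 (zero_add j)
    rwa [ha.1, hb.1] at this
  intro k
  induction k with
  | zero => intro i hi; rw [show i = j by omega]
  | succ k ih =>
    intro i hi
    rw [integralS1_chain_step hκ ha hb (by omega) (by omega), ih (i + 1) (by omega)]

theorem omegaD_evalDiff {κ : S1 → ℝ} (hκ : IsSmooth κ) (p : DiffPoly) :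
    omegaD κ (evalDiff κ p) = evalDiff κ (formalOmegaD p) := by
  funext s
  simp only [omegaD, dS_evalDiff hκ]
  simp [evalDiff, formalOmegaD, MvPolynomial.smul_eval]

/-- The Lenard sequence, evaluated at `κ`, is a recursion chain that starts at the constant `1`. -/
theorem isRecursionChain_lenard {κ : S1 → ℝ} (hκ : IsSmooth κ) (m : ℕ) :
    IsRecursionChain κ m (fun _ => 1) (fun k => evalDiff κ (lenard k)) := by
  refine ⟨?_, fun k _ => isSmooth_evalDiff hκ _, fun k _ => ?_⟩
  · funext s; simp [evalDiff, lenard]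
  · rw [dS_evalDiff hκ, totalD_lenard_succ, omegaD_evalDiff hκ]

/-- The chain exists because the obstructions `∫ Ω D_s (b k)` are the differentials
`dH_{k+1}(Y)`. -/
theorem exists_isRecursionChain {κ : S1 → ℝ} (hκ : IsSmooth κ) {β : S1 → ℝ} (hβ : IsSmooth β)
    {m : ℕ} (h : ∀ k < m,
      integralS1 (fun s => evalDiff κ (lenard k) s * omegaD κ β s) = 0) :
    ∃ b, IsRecursionChain κ m β b := by
  induction m with
  | zero => exact ⟨fun _ => β, rfl, fun _ _ => hβ, fun k hk => absurd hk k.not_lt_zero⟩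
  | succ m ih =>
    obtain ⟨b, hb⟩ := ih fun k hk => h k (hk.trans m.lt_succ_self)
    -- the Lenard chain starts at `1`, so this computes the mean of `Ω D_s (b m)`
    have h0 := integralS1_chain hκ (isRecursionChain_lenard hκ m) hb le_rfl le_rfl
    rw [h m m.lt_succ_self] at h0
    simp only [one_mul] at h0
    obtain ⟨F, hF, hFd⟩ := exists_dS_eq (hκ.omegaD (hb.2.1 m le_rfl)) h0
    refine ⟨fun k => if k ≤ m then b k else F, by simpa using hb.1, fun k _ => ?_, fun k hk => ?_⟩
    · by_cases hkm : k ≤ m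
      · simpa [hkm] using hb.2.1 k hkm
      · simpa [hkm] using hF
    · have hkm : k ≤ m := Nat.lt_succ_iff.1 hk
      rcases hkm.lt_or_eq with hlt | rfl
      · simpa [hkm, Nat.succ_le_of_lt hlt] using hb.2.2 k hlt
      · simpa using hFd

/-- The form `ω_{m+1}` does not depend on the choice of the primitives: if both `α` and `β` admit
chains, all of `Ω ^ m` can be moved to `α`. -/
theorem chainPairing_eq {κ : S1 → ℝ} (hκ : IsSmooth κ) {m : ℕ} {α β : S1 → ℝ}
    {a b : ℕ → S1 → ℝ} (ha : IsRecursionChain κ m α a) (hb : IsRecursionChain κ m β b) :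
    chainPairing κ m α b = integralS1 (fun s => a m s * omegaD κ β s) :=
  integralS1_chain hκ ha hb le_rfl le_rfl

theorem omegaForm_eq {m : ℕ} {γ X Y : S1 → Plane} (hγ : IsSmooth γ) {a b : ℕ → S1 → ℝ}
    (ha : IsRecursionChain (curvature γ) m (coord γ X) a)
    (hb : IsRecursionChain (curvature γ) m (coord γ Y) b) :
    omegaForm m γ X Y = chainPairing (curvature γ) m (coord γ X) b := by
  have h : ∃ b, IsRecursionChain (curvature γ) m (coord γ Y) b := ⟨b, hb⟩
  have hκ := isSmooth_curvature hγ
  rw [omegaForm, dif_pos h, chainPairing_eq hκ ha h.choose_spec, chainPairing_eq hκ ha hb]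

theorem exists_isRecursionChain_coord {m : ℕ} {γ X : S1 → Plane} (hγ : γ ∈ curveSpace)
    (hX : X ∈ tangentLevelSet m γ) : ∃ a, IsRecursionChain (curvature γ) m (coord γ X) a := by
  obtain ⟨α, hα, rfl, h⟩ := (mem_tangentLevelSet_iff hγ).1 hX
  rw [coord_motionField hγ]
  exact exists_isRecursionChain (isSmooth_curvature hγ.1) hα h

/-! ### The circle action -/

theorem dS_comp_add {E : Type*} [NormedAddCommGroup E] [NormedSpace ℝ E] (f : S1 → E) (σ : S1) :
    dS (fun s => f (s + σ)) = fun s => dS f (s + σ) := by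
  funext x
  simp only [dS, add_right_comm]

theorem iterate_dS_comp_add (f : S1 → ℝ) (σ : S1) (i : ℕ) :
    dS^[i] (fun s => f (s + σ)) = fun s => dS^[i] f (s + σ) := by
  induction i with
  | zero => rfl
  | succ i ih => rw [Function.iterate_succ_apply', ih, dS_comp_add, Function.iterate_succ_apply']

theorem IsSmooth.comp_add {E : Type*} [NormedAddCommGroup E] [NormedSpace ℝ E] {f : S1 → E}
    (hf : IsSmooth f) (σ : S1) : IsSmooth (fun s => f (s + σ)) := by
  induction σ using QuotientAddGroup.induction_on with
  | H a =>
    have h := ContDiff.comp (g := fun s : ℝ => f (s : S1)) hf (contDiff_id.add contDiff_const)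
      (f := fun s : ℝ => s + a)
    exact h

theorem integralS1_comp_add (f : S1 → ℝ) (σ : S1) :
    integralS1 (fun s => f (s + σ)) = integralS1 f := by
  induction σ using QuotientAddGroup.induction_on with
  | H a =>
    have h1 := intervalIntegral.integral_comp_add_right (a := 0) (b := 2 * Real.pi)
      (fun s : ℝ => f (s : S1)) a
    have h2 := (periodic_coe f).intervalIntegral_add_eq a 0
    rw [zero_add] at h1 h2
    rw [add_comm, h2] at h1
    exact h1

theorem curvature_shift (σ : S1) (γ : S1 → Plane) :
    curvature (shift σ γ) = fun s => curvature γ (s + σ) := by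
  unfold curvature shift
  simp only [dS_comp_add]

theorem hamiltonian_shift (n : ℕ) (σ : S1) (γ : S1 → Plane) :
    hamiltonian n (shift σ γ) = hamiltonian n γ := by
  rw [hamiltonian_eq, hamiltonian_eq, ← integralS1_comp_add (evalDiff (curvature γ) _) σ,
    curvature_shift]
  unfold evalDiff
  simp only [iterate_dS_comp_add]

theorem shift_mem_curveSpace (σ : S1) {γ : S1 → Plane} (hγ : γ ∈ curveSpace) :
    shift σ γ ∈ curveSpace := by
  refine ⟨hγ.1.comp_add σ, fun s => hγ.2.1 _, fun s => ?_⟩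
  unfold shift
  rw [dS_comp_add]
  exact hγ.2.2 _

theorem shift_mem_levelSet {C : ℕ → ℝ} {m : ℕ} (σ : S1) {γ : S1 → Plane} (hγ : γ ∈ levelSet C m) :
    shift σ γ ∈ levelSet C m :=
  ⟨shift_mem_curveSpace σ hγ.1, fun k h1 hk => (hamiltonian_shift k σ γ).trans (hγ.2 k h1 hk)⟩

theorem shift_motionField (σ : S1) (γ : S1 → Plane) (α : S1 → ℝ) :
    shift σ (motionField γ α) = motionField (shift σ γ) (fun s => α (s + σ)) := by
  unfold shift motionField
  simp only [dS_comp_add]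

theorem omegaD_comp_add (κ b : S1 → ℝ) (σ : S1) :
    omegaD (fun s => κ (s + σ)) (fun s => b (s + σ)) = fun s => omegaD κ b (s + σ) := by
  unfold omegaD
  simp only [dS_comp_add]

theorem IsRecursionChain.comp_add {κ β : S1 → ℝ} {m : ℕ} {b : ℕ → S1 → ℝ}
    (hb : IsRecursionChain κ m β b) (σ : S1) :
    IsRecursionChain (fun s => κ (s + σ)) m (fun s => β (s + σ)) (fun k s => b k (s + σ)) :=
  ⟨by simp only [hb.1], fun k hk => (hb.2.1 k hk).comp_add σ, fun k hk => by
    rw [dS_comp_add, omegaD_comp_add, hb.2.2 k hk]⟩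

theorem shift_mem_tangentLevelSet {m : ℕ} (σ : S1) {γ X : S1 → Plane} (hγ : γ ∈ curveSpace)
    (hX : X ∈ tangentLevelSet m γ) : shift σ X ∈ tangentLevelSet m (shift σ γ) := by
  obtain ⟨α, hα, rfl, h⟩ := (mem_tangentLevelSet_iff hγ).1 hX
  refine (mem_tangentLevelSet_iff (shift_mem_curveSpace σ hγ)).2
    ⟨_, hα.comp_add σ, shift_motionField σ γ α, fun k hk => ?_⟩
  rw [← h k hk, ← integralS1_comp_add
    (fun s => evalDiff (curvature γ) (lenard k) s * omegaD (curvature γ) α s) σ, curvature_shift,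
    omegaD_comp_add]
  unfold evalDiff
  simp only [iterate_dS_comp_add]

theorem omegaForm_shift {m : ℕ} (σ : S1) {γ X Y : S1 → Plane} (hγ : γ ∈ curveSpace)
    (hX : X ∈ tangentLevelSet m γ) (hY : Y ∈ tangentLevelSet m γ) :
    omegaForm m (shift σ γ) (shift σ X) (shift σ Y) = omegaForm m γ X Y := by
  obtain ⟨a, ha⟩ := exists_isRecursionChain_coord hγ hX
  obtain ⟨b, hb⟩ := exists_isRecursionChain_coord hγ hY
  have hcoord : ∀ Z, (fun s => coord γ Z (s + σ)) = coord (shift σ γ) (shift σ Z) := fun _ => rfl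
  have ha' := ha.comp_add σ
  have hb' := hb.comp_add σ
  rw [← curvature_shift] at ha' hb'
  have h := omegaForm_eq (X := shift σ X) (Y := shift σ Y) (shift_mem_curveSpace σ hγ).1
    (hcoord X ▸ ha') (hcoord Y ▸ hb')
  rw [h, omegaForm_eq hγ.1 ha hb, chainPairing,
    chainPairing, curvature_shift, omegaD_comp_add]
  exact integralS1_comp_add (fun s => coord γ X s * omegaD (curvature γ) (b m) s) σ

theorem fundamentalField_eq {γ : S1 → Plane} (hγ : IsSmooth γ) (ξ : ℝ) :
    fundamentalField ξ γ = motionField γ (fun _ => ξ) := by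
  funext s
  have h1 : HasDerivAt (fun t : ℝ => t * ξ) ξ 0 := by
    simpa using (hasDerivAt_id (0 : ℝ)).mul_const ξ
  have h2 : HasDerivAt (fun t : ℝ => γ (s + (t : S1))) (dS γ s) (0 * ξ) := by
    rw [zero_mul]; exact hγ.hasDerivAt s
  have h3 := (h2.scomp (0 : ℝ) h1).deriv
  simp only [motionField, dS_const, mul_zero, zero_smul, zero_add]
  exact h3

/-- Translation is the motion with constant `α`. The constant `ξ` starts the multiple `ξ b_k(κ)` of
the Lenard chain, so that `∫ b_k Ω D_s ξ = -∫ Ω D_s b_k ξ` is the integral of a derivative. -/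
theorem fundamentalField_mem_tangentLevelSet {γ : S1 → Plane} (hγ : γ ∈ curveSpace) (ξ : ℝ)
    (m : ℕ) : fundamentalField ξ γ ∈ tangentLevelSet m γ := by
  have hκ := isSmooth_curvature hγ.1
  refine (mem_tangentLevelSet_iff hγ).2
    ⟨_, isSmooth_const ξ, fundamentalField_eq hγ.1 ξ, fun k _ => ?_⟩
  have hc := isRecursionChain_lenard hκ (k + 1)
  rw [integralS1_mul_omegaD hκ (hc.2.1 k k.le_succ) (isSmooth_const ξ), ← hc.2.2 k k.lt_succ_self]
  simp only [mul_comm _ ξ]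
  rw [integralS1_const_mul, integralS1_dS (hc.2.1 (k + 1) le_rfl), mul_zero, neg_zero]

/-- The contraction of `ω_{m+1}` with the fundamental vector field is `ξ dH_{m+1}`. -/
theorem omegaForm_fundamentalField {m : ℕ} {γ : S1 → Plane} (hγ : γ ∈ curveSpace) (ξ : ℝ)
    {β : S1 → ℝ} (hY : motionField γ β ∈ tangentLevelSet m γ) :
    omegaForm m γ (fundamentalField ξ γ) (motionField γ β) =
      integralS1 (fun s => evalDiff (curvature γ) (lenard m) s * omegaD (curvature γ) β s) * ξ := by
  have hκ := isSmooth_curvature hγ.1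
  obtain ⟨a, ha⟩ :=
    exists_isRecursionChain_coord hγ (fundamentalField_mem_tangentLevelSet hγ ξ m)
  obtain ⟨b, hb⟩ := exists_isRecursionChain_coord hγ hY
  rw [omegaForm_eq hγ.1 ha hb, fundamentalField_eq hγ.1, coord_motionField hγ, chainPairing,
    integralS1_const_mul]
  rw [coord_motionField hγ] at hb
  rw [← integralS1_chain hκ (isRecursionChain_lenard hκ m) hb le_rfl le_rfl, mul_comm]
  simp only [one_mul]

end

end KdVCurve

open KdVCurve
theorem theorem3p4 (C : ℕ → ℝ) (m : ℕ) (hm : 1 ≤ m) :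
    -- the densities `h₁, h₂, …` exist
    (∀ k, 1 ≤ k → IsKdVDensity k (kdvDensity k)) ∧
    -- `ω_{m+1}` is well defined on `𝓜(C_m)`
    (∀ γ ∈ levelSet C m, ∀ X ∈ tangentLevelSet m γ, ∀ Y ∈ tangentLevelSet m γ,
      (∃ b, IsRecursionChain (curvature γ) m (coord γ Y) b) ∧
      ∀ b, IsRecursionChain (curvature γ) m (coord γ Y) b →
        omegaForm m γ X Y = chainPairing (curvature γ) m (coord γ X) b) ∧
    -- the action is Hamiltonian, with moment map `⟨μ(γ), ∂/∂σ⟩ = H_{m+1}(γ)`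
    IsHamiltonianWithMomentMap C m
      (fun γ => hamiltonian (m + 1) γ • (LinearMap.id : ℝ →ₗ[ℝ] ℝ)) := by
  refine ⟨fun k hk => isKdVDensity_kdvDensity hk, fun γ hγ X hX Y hY => ?_, ?_⟩
  · obtain ⟨a, ha⟩ := exists_isRecursionChain_coord hγ.1 hX
    exact ⟨exists_isRecursionChain_coord hγ.1 hY, fun b hb => omegaForm_eq hγ.1.1 ha hb⟩
  · exact
      { shift_mem := fun σ γ hγ => shift_mem_levelSet σ hγ
        shift_tangent := fun σ γ hγ X hX => shift_mem_tangentLevelSet σ hγ.1 hX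
        form_invariant := fun σ γ hγ X hX Y hY => omegaForm_shift σ hγ.1 hX hY
        fundamental_tangent := fun ξ γ hγ => fundamentalField_mem_tangentLevelSet hγ.1 ξ m
        equivariant := fun σ γ _ => by rw [hamiltonian_shift]
        differential := fun ξ γ hγ Y hY Γ hΓ => by
          obtain ⟨β, hβ, rfl⟩ := hY.1
          rw [omegaForm_fundamentalField hγ.1 ξ hY]
          exact (hasDifferential_hamiltonian hγ.1 hβ m Γ hΓ).mul_const ξ }
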